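/- Let $a\ge 0$ be an integer. There is a constant $B$ (depending only on $a$) such that for every integer $k\ge 0$ there are constants $c>0$ and $K$ (depending only on $a$ and $k$) and a randomized synchronous message-passing algorithm $\mathcal A$ (the code of a node may depend on $n$) that, for all $n\ge 3$, runs in at most $K\log\log n$ rounds and sends messages of at most $B\log n$ bits (the $\mathsf{CONGEST}$ model), with the following guarantee. Let $G$ be a graph with $n$ nodes and maximum degree $\Delta$, whose nodes have distinct IDs in $\{0,\dots,n^a-1\}$, and let $\varepsilon\le 1/15$ satisfy $\varepsilon\Delta>c\log^2 n$. Call a node set $C$ an almost-clique if $(1-\varepsilon)\Delta\le |C|\le(1+\varepsilon)\Delta$ and every $v\in C$ has at least $(1-\varepsilon)\Delta$ neighbors in $C$. Let any family of pairwise disjoint almost-cliques be given (for instance a single one, or those of an almost-clique decomposition), with distinct AC-IDs in $\{0,\dots,n^a-1\}$ and with a leader node $w_C\in C$ in each member $C$. Initially each node knows its ID, the IDs of its neighbors, the AC-ID of the member that contains it (if any), whether it is its leader, and a private random seed, uniform on a finite set and independent of the seeds of the other nodes. Then, with probability at least $1-n^{-k}$, algorithm $\mathcal A$ computes a clique overlay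 of congestion at most $2$ for every member $C$ of the family. Here a clique overlay of $C$ is a collection $O$ of paths of length $2$ in $G[C]$ that contains a path between any two distinct non-adjacent nodes of $C$. Its congestion is the maximum, over the edges $e$ of $G$, of the number of occurrences of $e$ in paths of $O$. The algorithm computes $O$ if each node $u\in C$ outputs a partial map on IDs, defined exactly at the IDs of the non-neighbors $v\ne u$ of $u$ in $C$, such that for every non-edge $\{u,v\}$ of $G[C]$ there is a path $u - w - v$ in $O$ for which $u$ outputs $w$ at $v$, and $v$ outputs $w$ at $u$. -/

import Mathlib

/-- A randomized synchronous message-passing algorithm with `msgBits`-bit messages, as a piece of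
code that is run by every node. Local computation is unrestricted.
* `init`: the initial state of a node, from its own ID, the IDs of its neighbours, its local input
  and its private random seed (uniform on the finite set `Seed`, independent between nodes);
* `send`: the message sent in a round to the neighbour with the given ID;
* `recv`: the new state, from the old one and the set of received pairs
  (ID of the sending neighbour, message);
* `rounds`: the number of communication rounds after which `output` is read off. -/
structure CongestAlgorithm (In Out : Type) where
  Seed : Type
  [seedFintype : Fintype Seed]
  [seedNonempty : Nonempty Seed]
  State : Type
  msgBits : ℕ
  rounds : ℕ
  init : ℕ → Finset ℕ → In → Seed → State
  send : State → ℕ → (Fin msgBits → Bool)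
  recv : State → Finset (ℕ × (Fin msgBits → Bool)) → State
  output : State → Out

attribute [instance] CongestAlgorithm.seedFintype CongestAlgorithm.seedNonempty

namespace CongestAlgorithm

variable {In Out V : Type} [Fintype V] [DecidableEq V]

/-- The state of node `v` after `t` rounds, in the network `G` with node IDs `id`, local inputs
`input` and private random seeds `ω`. -/
def stateAt (A : CongestAlgorithm In Out) (G : SimpleGraph V) [DecidableRel G.Adj]
    (id : V ↪ ℕ) (input : V → In) (ω : V → A.Seed) : ℕ → V → A.State
  | 0, v => A.init (id v) ((G.neighborFinset v).map id) (input v) (ω v)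
  | t + 1, v =>
      A.recv (A.stateAt G id input ω t v)
        ((G.neighborFinset v).image
          fun u => (id u, A.send (A.stateAt G id input ω t u) (id v)))

/-- The output of node `v` at the end of the execution. -/
def run (A : CongestAlgorithm In Out) (G : SimpleGraph V) [DecidableRel G.Adj]
    (id : V ↪ ℕ) (input : V → In) (ω : V → A.Seed) (v : V) : Out :=
  A.output (A.stateAt G id input ω A.rounds v)

/-- The probability of an event when the nodes draw independent uniform seeds. -/
noncomputable def prob (A : CongestAlgorithm In Out) (E : Set (V → A.Seed)) : ℝ :=
  (E.ncard : ℝ) / (Fintype.card (V → A.Seed) : ℝ)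

end CongestAlgorithm

section CliqueOverlay

variable {V : Type} [Fintype V] [DecidableEq V]

/-- `C` is an `ε`-almost-clique of `G`, where `Δ = G.maxDegree`:
`(1 - ε)Δ ≤ |C| ≤ (1 + ε)Δ`, and `|N(v) ∩ C| ≥ (1 - ε)Δ` for every `v ∈ C`. -/
def IsAlmostClique (G : SimpleGraph V) [DecidableRel G.Adj] (ε : ℝ) (C : Finset V) : Prop :=
  (1 - ε) * (G.maxDegree : ℝ) ≤ (C.card : ℝ) ∧
  (C.card : ℝ) ≤ (1 + ε) * (G.maxDegree : ℝ) ∧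
  ∀ v ∈ C, (1 - ε) * (G.maxDegree : ℝ) ≤ ((G.neighborFinset v ∩ C).card : ℝ)

/-- `u` and `v` are distinct non-adjacent nodes of `C`. -/
def IsNonEdge (G : SimpleGraph V) (C : Finset V) (u v : V) : Prop :=
  u ∈ C ∧ v ∈ C ∧ u ≠ v ∧ ¬ G.Adj u v

/-- The pair `(s(u, v), w)` stands for the undirected path `u - w - v`. It is a path of length 2
in `G[C]` if `u ≠ v`, all three nodes are in `C`, and `w` is adjacent to `u` and `v`. -/
def IsTwoPath (G : SimpleGraph V) (C : Finset V) (p : Sym2 V × V) : Prop :=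
  ¬ p.1.IsDiag ∧ p.2 ∈ C ∧ ∀ x ∈ p.1, x ∈ C ∧ G.Adj x p.2

/-- A clique overlay of `C`: a collection of length-2 paths in `G[C]` that contains a path between
any two non-adjacent nodes of `C`. -/
def IsCliqueOverlay (G : SimpleGraph V) (C : Finset V) (O : Finset (Sym2 V × V)) : Prop :=
  (∀ p ∈ O, IsTwoPath G C p) ∧
  ∀ u v, IsNonEdge G C u v → ∃ w, (s(u, v), w) ∈ O

/-- The number of occurrences of the edge `e` in the collection `O` of length-2 paths. -/
def edgeOccurrences (O : Finset (Sym2 V × V)) (e : Sym2 V) : ℕ :=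
  (O.filter fun p => ∃ x : V, x ∈ p.1 ∧ e = s(x, p.2)).card

/-- The congestion of a collection of length-2 paths: the maximum number of occurrences of an edge
of `G` in it. -/
def overlayCongestion (G : SimpleGraph V) [DecidableRel G.Adj] (O : Finset (Sym2 V × V)) : ℕ :=
  G.edgeFinset.sup (edgeOccurrences O)

/-- The outputs `out` of the nodes describe the overlay `O` of `C`. The output of a node `u ∈ C` is
a partial map from IDs to IDs, defined exactly at the IDs of the non-neighbours of `u` in `C`. For
every non-edge `{u, v}` of `G[C]`, both `u` and `v` know the node `w` that forwards messages
between them in `O`. -/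
def KnowsOverlay (G : SimpleGraph V) (id : V ↪ ℕ) (C : Finset V) (O : Finset (Sym2 V × V))
    (out : V → ℕ → Option ℕ) : Prop :=
  (∀ u v, IsNonEdge G C u v →
    ∃ w, (s(u, v), w) ∈ O ∧ out u (id v) = some (id w) ∧ out v (id u) = some (id w)) ∧
  ∀ u ∈ C, ∀ i : ℕ, (∀ v, IsNonEdge G C u v → id v ≠ i) → out u i = none

/-- The local input of a node: the AC-ID of the almost-clique that contains it (`none` if there is
none), and whether it is the leader of that almost-clique. -/
structure CliqueInput where
  acId : Option ℕ
  isLeader : Bool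

/-- The set of nodes with AC-ID `i`. -/
def acNodes (input : V → CliqueInput) (i : ℕ) : Finset V :=
  Finset.univ.filter fun v => (input v).acId = some i

end CliqueOverlay

/-! Choosing a middle node for every non-edge of `G[C]` means colouring the edges of the complement
of `G[C]`, with the nodes of `C` as colours. If the non-edges at each node get distinct colours, an
edge `{a, b}` of `G` occurs at most once with `a` as end and `b` as middle, and at most once the
other way round; this gives congestion `2` (`edgeOccurrences_pathsOf_le`). By `ε ≤ 1/15`, a node of
`C` is non-adjacent to at most `N/8` of the `N = |C|` nodes (`not_adj_card_le`), so colours are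
plentiful compared with the complement degree and random trials work.

A trial for `{u, v}` is a uniform colour. Within a phase the lexicographically smaller pair has
priority, so the set of colours that can fail is determined by earlier phases and smaller pairs. At
most `3N/4` colours fail (`four_mul_card_badColors_le`): for each end, `N/8` non-neighbours, `N/8`
colours in use and `N/8` colours tried in the same phase. Hence `m` given trials all fail with
probability at most `(3/4)^m`, despite their dependence (`card_trials_fail_le`).

Let `l` be a suitable multiple of `log n`. After `O(log l) = O(log log n)` phases with one trial per
non-edge, a union bound over sets of `r ≈ N/(8l)` non-edges at a node shows that fewer than `r`
remain uncoloured at each node. One more phase can then afford `l` trials for each remaining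
non-edge, and `(3/4)^l` is polynomially small (`card_process_fail_le`, `fail_bound`).

To sample colours, the nodes of `C` are first numbered `0, …, N - 1` in a constant number of rounds,
with the help of the leader (`lab_bijOn`). A phase then costs two rounds, requests to the tried
middle nodes and their answers, and `IsLabelled.simulates` shows that the network follows the
abstract process. -/

namespace CliqueOverlay

open Finset

/-! ### Counting bounds for sequentially dependent trials. -/

/-- Resampling one coordinate: if neither `P` nor the forbidden set `bad` depends on coordinate
`i`, then requiring `ω i ∈ bad ω` costs a factor `q`. -/
theorem card_filter_coord_le {ι α : Type*} [Fintype ι] [DecidableEq ι] [Fintype α] [DecidableEq α]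
    (i : ι) (P : (ι → α) → Prop) [DecidablePred P] (bad : (ι → α) → Finset α) (q : ℝ)
    (hP : ∀ ω a, P (Function.update ω i a) ↔ P ω)
    (hbad : ∀ ω a, bad (Function.update ω i a) = bad ω)
    (hq : ∀ ω, ((bad ω).card : ℝ) ≤ q * Fintype.card α) [Nonempty α] :
    ((univ.filter fun ω : ι → α => P ω ∧ ω i ∈ bad ω).card : ℝ)
      ≤ q * (univ.filter fun ω : ι → α => P ω).card := by
  have hα : (0 : ℝ) < Fintype.card α := by exact_mod_cast Fintype.card_pos
  have key : (univ.filter fun ω : ι → α => P ω ∧ ω i ∈ bad ω).card * Fintype.card α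
      ≤ ∑ ω ∈ univ.filter (fun ω : ι → α => P ω), (bad ω).card := by
    rw [← Finset.card_sigma, ← Finset.card_univ (α := α), ← Finset.card_product]
    -- Swap the coordinate `ω i` with a fresh value `a`: the swap is invertible, and it leaves `P`
    -- and `bad` unchanged.
    refine Finset.card_le_card_of_injOn
      (fun p => (⟨Function.update p.1 i p.2, p.1 i⟩ : (_ : ι → α) × α)) ?_ ?_
    · rintro ⟨ω, a⟩ h
      simp only [coe_product, Set.mem_prod, mem_coe, mem_filter, mem_univ, true_and, and_true] at h
      simp [hP, hbad, h.1, h.2]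
    · rintro ⟨ω, a⟩ _ ⟨ω', a'⟩ _ h
      simp only [Sigma.mk.injEq, heq_eq_eq] at h
      obtain ⟨h1, h2⟩ := h
      have ha : a = a' := by simpa using congrFun h1 i
      have hω : ω = ω' := by
        funext j
        by_cases hj : j = i
        · rw [hj, h2]
        · simpa [hj] using congrFun h1 j
      rw [ha, hω]
  have h2 : (∑ ω ∈ univ.filter (fun ω : ι → α => P ω), ((bad ω).card : ℝ))
      ≤ (univ.filter fun ω : ι → α => P ω).card * (q * Fintype.card α) := by
    rw [← nsmul_eq_mul]
    exact Finset.sum_le_card_nsmul _ _ _ fun ω _ => hq ω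
  have h3 : ((univ.filter fun ω : ι → α => P ω ∧ ω i ∈ bad ω).card : ℝ) * Fintype.card α
      ≤ (univ.filter fun ω : ι → α => P ω).card * (q * Fintype.card α) :=
    le_trans (by exact_mod_cast key) h2
  nlinarith

/-- If each trial `j ∈ S` fails only when its coordinate lies in a set of density at most `q`
that is determined by the earlier trials, then all trials fail with probability at most
`q ^ #S`. -/
theorem card_all_fail_le {ι α J β : Type*} [Fintype ι] [DecidableEq ι] [Fintype α]
    [DecidableEq α] [Nonempty α] [DecidableEq J] [LinearOrder β]
    (key : J → β) (κ : J → ι) (bad : J → (ι → α) → Finset α) (q : ℝ) (hq0 : 0 ≤ q)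
    (S : Finset J) (hκ : Set.InjOn κ S)
    (hinv : ∀ i ∈ S, ∀ j ∈ S, key i ≤ key j → ∀ ω a,
      bad i (Function.update ω (κ j) a) = bad i ω)
    (hq : ∀ i ∈ S, ∀ ω, ((bad i ω).card : ℝ) ≤ q * Fintype.card α) :
    ((univ.filter fun ω : ι → α => ∀ i ∈ S, ω (κ i) ∈ bad i ω).card : ℝ)
      ≤ q ^ S.card * Fintype.card (ι → α) := by
  -- Peel off a trial with the largest key: neither the other trials nor their forbidden sets see
  -- its coordinate.
  induction S using Finset.induction_on_max_value key with
  | empty => simp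
  | insert j S hj hmax ih =>
    have ih' := ih (hκ.mono (by simp)) (fun i hi k hk => hinv i (by simp [hi]) k (by simp [hk]))
      (fun i hi => hq i (by simp [hi]))
    have h := card_filter_coord_le (κ j) (fun ω : ι → α => ∀ i ∈ S, ω (κ i) ∈ bad i ω) (bad j) q
      (by
        intro ω a
        refine forall₂_congr fun i hi => ?_
        rw [hinv i (by simp [hi]) j (by simp) (hmax i hi), Function.update_of_ne]
        intro hij
        have := hκ (by simp [hi]) (by simp) hij
        exact hj (this ▸ hi))
      (hinv j (by simp) j (by simp) le_rfl) (hq j (by simp))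
    have e : (univ.filter fun ω : ι → α => ∀ i ∈ insert j S, ω (κ i) ∈ bad i ω)
        = univ.filter fun ω : ι → α => (∀ i ∈ S, ω (κ i) ∈ bad i ω) ∧ ω (κ j) ∈ bad j ω := by
      ext ω; simp [and_comm]
    rw [e, Finset.card_insert_of_notMem hj, pow_succ']
    calc _ ≤ _ := h
      _ ≤ q * (q ^ S.card * Fintype.card (ι → α)) := by gcongr
      _ = _ := by ring

/-- A residue modulo `N` of a uniform element of `Fin M`, `N ∣ M`, is uniform. -/
theorem card_filter_mod_mem_le (M N : ℕ) (hN : N ∣ M) (B : Finset ℕ) :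
    (univ.filter fun a : Fin M => a.val % N ∈ B).card * N ≤ B.card * M := by
  obtain ⟨q, rfl⟩ := hN
  have : (univ.filter fun a : Fin (N * q) => a.val % N ∈ B).card ≤ (B ×ˢ range q).card := by
    refine Finset.card_le_card_of_injOn (fun a => (a.val % N, a.val / N)) ?_ ?_
    · intro a ha
      simp only [coe_filter, mem_univ, true_and, Set.mem_ofPred_eq] at ha
      simp only [coe_product, coe_range, Set.mem_prod, mem_coe, ha, Set.mem_Iio, true_and]
      exact Nat.div_lt_of_lt_mul a.2
    · intro a _ b _ h
      simp only [Prod.mk.injEq] at h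
      apply Fin.ext
      rw [← Nat.div_add_mod a.val N, ← Nat.div_add_mod b.val N, h.1, h.2]
  rw [card_product, card_range] at this
  calc _ ≤ B.card * q * N := Nat.mul_le_mul_right _ this
    _ = _ := by ring

end CliqueOverlay

namespace CliqueOverlay

open Finset
open scoped Classical

/-! ### Edge colouring of the complement graph by random trials

Nodes and colours are the labels `0, …, N - 1`, and `R` is adjacency. A non-edge `{u, v}`, `u < v`,
is coloured by a common neighbour `w`, the middle node of the path `u - w - v`. -/

/-- Node `u` with neighbours `nb` and partners `out` wants `w` as the middle of a path to `v`; `y`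
are the colours it tries, `L` for each `v`. -/
def Wants (N u : ℕ) (nb : ℕ → Prop) (out : ℕ → Option ℕ) (L : ℕ) (y : ℕ → ℕ → ℕ) (w v : ℕ) :
    Prop :=
  u < v ∧ v < N ∧ ¬ nb v ∧ out v = none ∧ ∃ l < L, y v l = w

/-- The least `v` for which `u` wants `w`: this is what `u` requests from `w`. -/
def Requests (N u : ℕ) (nb : ℕ → Prop) (out : ℕ → Option ℕ) (L : ℕ) (y : ℕ → ℕ → ℕ) (w v : ℕ) :
    Prop :=
  Wants N u nb out L y w v ∧ ∀ v' < v, ¬ Wants N u nb out L y w v'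

/-- A node with neighbours `nb`, of which it already serves those in `busy`, and which has received
the requests `req`, accepts to connect `u` and `v`. -/
def Accepts (nb busy : ℕ → Prop) (req : ℕ → ℕ → Prop) (u v : ℕ) : Prop :=
  req u v ∧ nb v ∧ ¬ busy u ∧ ¬ busy v ∧ ∀ u' < u, ∀ v', req u' v' → v' ≠ u ∧ v' ≠ v

/-- `Accepts`, symmetrized. -/
def Mates (nb busy : ℕ → Prop) (req : ℕ → ℕ → Prop) (u v : ℕ) : Prop :=
  Accepts nb busy req u v ∨ Accepts nb busy req v u

/-- A node updates its middle nodes, where `mid v c` says that `c` has accepted to connect it to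
`v`. -/
noncomputable def newOut (out : ℕ → Option ℕ) (mid : ℕ → ℕ → Prop) (v : ℕ) : Option ℕ :=
  if out v = none then (if ∃ c, mid v c then some (sInf {c | mid v c}) else none) else out v

/-- State of the colouring process: `busy w x` says that `w` serves `x` in some path, and
`out u v` is the middle node chosen for `{u, v}`. -/
structure PState where
  busy : ℕ → ℕ → Prop
  out : ℕ → ℕ → Option ℕ

/-- The requests that reach `w`. -/
def reqAt (N : ℕ) (R : ℕ → ℕ → Prop) (L : ℕ) (s : PState) (y : ℕ → ℕ → ℕ → ℕ) (w u v : ℕ) : Prop :=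
  R w u ∧ Requests N u (R u) (s.out u) L (y u) w v

/-- `w` connects `u` and `v` in this phase. -/
def mateAt (N : ℕ) (R : ℕ → ℕ → Prop) (L : ℕ) (s : PState) (y : ℕ → ℕ → ℕ → ℕ) (w u v : ℕ) : Prop :=
  Mates (R w) (s.busy w) (reqAt N R L s y w) u v

/-- One phase. -/
noncomputable def PState.step (N : ℕ) (R : ℕ → ℕ → Prop) (L : ℕ) (s : PState)
    (y : ℕ → ℕ → ℕ → ℕ) : PState where
  busy w x := s.busy w x ∨ ∃ z, mateAt N R L s y w x z
  out u := newOut (s.out u) fun v c => mateAt N R L s y c u v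

/-- The state after `t` phases, with `L t` trials for each non-edge in phase `t`. -/
noncomputable def pstate (N : ℕ) (R : ℕ → ℕ → Prop) (L : ℕ → ℕ) (y : ℕ → ℕ → ℕ → ℕ → ℕ) : ℕ → PState
  | 0 => ⟨fun _ _ => False, fun _ _ => none⟩
  | t + 1 => (pstate N R L y t).step N R (L t) (y t)

variable {N : ℕ} {R : ℕ → ℕ → Prop} {L : ℕ → ℕ} {y : ℕ → ℕ → ℕ → ℕ → ℕ}

theorem wants_congr {u : ℕ} {nb : ℕ → Prop} {out : ℕ → Option ℕ} {L : ℕ} {y y' : ℕ → ℕ → ℕ}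
    {w v : ℕ} (h : u < v → v < N → ∀ l < L, y v l = y' v l) :
    Wants N u nb out L y w v ↔ Wants N u nb out L y' w v := by
  unfold Wants
  refine and_congr_right fun h1 => and_congr_right fun h2 => and_congr_right fun _ =>
    and_congr_right fun _ => exists_congr fun l => and_congr_right fun hl => ?_
  rw [h h1 h2 l hl]

theorem requests_congr {u : ℕ} {nb : ℕ → Prop} {out : ℕ → Option ℕ} {L : ℕ} {y y' : ℕ → ℕ → ℕ}
    {w v : ℕ} (h : ∀ v, u < v → v < N → ∀ l < L, y v l = y' v l) :
    Requests N u nb out L y w v ↔ Requests N u nb out L y' w v := by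
  unfold Requests
  exact and_congr (wants_congr (h v)) (forall₂_congr fun v' _ => not_congr (wants_congr (h v')))

theorem PState.step_congr {L : ℕ} {s : PState} {y y' : ℕ → ℕ → ℕ → ℕ}
    (h : ∀ u v, u < v → v < N → ∀ l < L, y u v l = y' u v l) :
    s.step N R L y = s.step N R L y' := by
  have : reqAt N R L s y = reqAt N R L s y' := by
    funext w u v
    exact propext (and_congr_right fun _ => requests_congr (h u))
  have : mateAt N R L s y = mateAt N R L s y' := by
    funext w u v
    simp only [mateAt, this]
  simp only [PState.step, this]

/-- This is the independence of the past from the trials of phase `t` and later; only trials inside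
the box `u < v < N`, `l < L t'` are ever read. -/
theorem pstate_congr {y y' : ℕ → ℕ → ℕ → ℕ → ℕ} (t : ℕ)
    (h : ∀ t' < t, ∀ u v, u < v → v < N → ∀ l < L t', y t' u v l = y' t' u v l) :
    pstate N R L y t = pstate N R L y' t := by
  induction t with
  | zero => rfl
  | succ t ih =>
    rw [pstate, pstate, ih fun t' ht' => h t' (by omega)]
    exact PState.step_congr (h t (by omega))

theorem mates_comm {nb busy : ℕ → Prop} {req : ℕ → ℕ → Prop} {u v : ℕ} :
    Mates nb busy req u v ↔ Mates nb busy req v u := or_comm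

theorem newOut_eq_none_iff {out : ℕ → Option ℕ} {mid : ℕ → ℕ → Prop} {v : ℕ} :
    newOut out mid v = none ↔ out v = none ∧ ∀ c, ¬ mid v c := by
  unfold newOut
  split_ifs with h1 h2 <;> simp_all

theorem newOut_eq_some {out : ℕ → Option ℕ} {mid : ℕ → ℕ → Prop} {v w : ℕ}
    (h : newOut out mid v = some w) : out v = some w ∨ out v = none ∧ mid v w := by
  unfold newOut at h
  split_ifs at h with h1 h2
  · right
    refine ⟨h1, ?_⟩
    have : sInf {c | mid v c} = w := by simpa using h
    rw [← this]
    exact Nat.sInf_mem (s := {c | mid v c}) h2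
  · left; exact h

/-- The accepted pairs at a node form a matching. -/
theorem Mates.unique {nb busy : ℕ → Prop} {req : ℕ → ℕ → Prop}
    (hlt : ∀ u v, req u v → u < v) (huniq : ∀ u v v', req u v → req u v' → v = v')
    {x z z' : ℕ} (h : Mates nb busy req x z) (h' : Mates nb busy req x z') : z = z' := by
  rcases h with ⟨h1, h2, h3, h4, h5⟩ | ⟨h1, h2, h3, h4, h5⟩ <;>
  rcases h' with ⟨g1, g2, g3, g4, g5⟩ | ⟨g1, g2, g3, g4, g5⟩
  -- If `x` is the smaller end of both pairs, it made only one request. If it is the smaller end of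
  -- one and the larger end of the other, the request ending at `x` comes from a smaller node and
  -- blocks the other pair. If it is the larger end of both, the pair with the smaller requester
  -- blocks the other.
  · exact huniq _ _ _ h1 g1
  · exact absurd rfl (h5 _ (hlt _ _ g1) _ g1).1
  · exact absurd rfl (g5 _ (hlt _ _ h1) _ h1).1
  · rcases lt_trichotomy z z' with h | h | h
    · exact absurd rfl (g5 _ h _ h1).2
    · exact h
    · exact absurd rfl (h5 _ h _ g1).2

theorem reqAt_lt {L : ℕ} {s : PState} {y : ℕ → ℕ → ℕ → ℕ} {w u v : ℕ}
    (h : reqAt N R L s y w u v) : u < v := h.2.1.1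

theorem reqAt_unique {L : ℕ} {s : PState} {y : ℕ → ℕ → ℕ → ℕ} {w u v v' : ℕ}
    (h : reqAt N R L s y w u v) (h' : reqAt N R L s y w u v') : v = v' := by
  rcases lt_trichotomy v v' with hv | hv | hv
  · exact absurd h.2.1 (h'.2.2 _ hv)
  · exact hv
  · exact absurd h'.2.1 (h.2.2 _ hv)

theorem mateAt_unique {L : ℕ} {s : PState} {y : ℕ → ℕ → ℕ → ℕ} {w x z z' : ℕ}
    (h : mateAt N R L s y w x z) (h' : mateAt N R L s y w x z') : z = z' :=
  Mates.unique (fun _ _ => reqAt_lt) (fun _ _ _ => reqAt_unique) h h'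

theorem mateAt_comm {L : ℕ} {s : PState} {y : ℕ → ℕ → ℕ → ℕ} {w u v : ℕ} :
    mateAt N R L s y w u v ↔ mateAt N R L s y w v u := mates_comm

theorem PState.step_out_eq_none_iff {L : ℕ} {s : PState} {y : ℕ → ℕ → ℕ → ℕ} {u v : ℕ} :
    (s.step N R L y).out u v = none ↔ s.out u v = none ∧ ∀ c, ¬ mateAt N R L s y c u v :=
  newOut_eq_none_iff (mid := fun v c => mateAt N R L s y c u v)

theorem PState.step_out_eq_some {L : ℕ} {s : PState} {y : ℕ → ℕ → ℕ → ℕ} {u v w : ℕ}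
    (h : (s.step N R L y).out u v = some w) :
    s.out u v = some w ∨ s.out u v = none ∧ mateAt N R L s y w u v :=
  newOut_eq_some (mid := fun v c => mateAt N R L s y c u v) h

/-- The invariants of the process. -/
structure PState.Good (N : ℕ) (R : ℕ → ℕ → Prop) (s : PState) : Prop where
  symm : ∀ u v, s.out u v = s.out v u
  path : ∀ u v w, s.out u v = some w →
    R w u ∧ R w v ∧ ¬ R u v ∧ u ≠ v ∧ u < N ∧ v < N ∧ s.busy w u
  inj : ∀ u v v' w, s.out u v = some w → s.out u v' = some w → v = v'

theorem mateAt_prop (hR : ∀ u v, R u v → R v u) {L : ℕ} {s : PState} (hs : s.Good N R)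
    {y : ℕ → ℕ → ℕ → ℕ} {w u v : ℕ}
    (h : mateAt N R L s y w u v) :
    R w u ∧ R w v ∧ ¬ R u v ∧ u ≠ v ∧ u < N ∧ v < N ∧ ¬ s.busy w u ∧ ¬ s.busy w v ∧
      s.out u v = none := by
  rcases h with ⟨h1, h2, h3, h4, h5⟩ | ⟨h1, h2, h3, h4, h5⟩
  · obtain ⟨a, ⟨b, c, d, e, -⟩, -⟩ := h1
    exact ⟨a, h2, d, b.ne, b.trans c, c, h3, h4, e⟩
  · obtain ⟨a, ⟨b, c, d, e, -⟩, -⟩ := h1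
    exact ⟨h2, a, fun h => d (hR _ _ h), b.ne', c, b.trans c, h4, h3, hs.symm u v ▸ e⟩

/-- Colours stay distinct at each node: a new colour differs from the old ones because a busy pair
is never accepted again, and two new ones differ because acceptances at a middle node form a
matching. -/
theorem PState.Good.step (hR : ∀ u v, R u v → R v u) {L : ℕ} {s : PState} (hs : s.Good N R)
    (y : ℕ → ℕ → ℕ → ℕ) : (s.step N R L y).Good N R where
  symm u v := by
    simp only [PState.step, newOut, hs.symm u v, mateAt_comm (u := u) (v := v)]
  path u v w h := by
    rcases PState.step_out_eq_some h with h | ⟨-, h⟩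
    · obtain ⟨a, b, c, d, e, f, g⟩ := hs.path u v w h
      exact ⟨a, b, c, d, e, f, Or.inl g⟩
    · obtain ⟨a, b, c, d, e, f, -⟩ := mateAt_prop hR hs h
      exact ⟨a, b, c, d, e, f, Or.inr ⟨v, h⟩⟩
  inj u v v' w h h' := by
    rcases PState.step_out_eq_some h with h | ⟨-, h⟩ <;> rcases PState.step_out_eq_some h' with h' | ⟨-, h'⟩
    · exact hs.inj _ _ _ _ h h'
    · exact absurd (hs.path _ _ _ h).2.2.2.2.2.2 (mateAt_prop hR hs h').2.2.2.2.2.2.1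
    · exact absurd (hs.path _ _ _ h').2.2.2.2.2.2 (mateAt_prop hR hs h).2.2.2.2.2.2.1
    · exact mateAt_unique h h'

theorem pstate_good (hR : ∀ u v, R u v → R v u) (t : ℕ) : (pstate N R L y t).Good N R := by
  induction t with
  | zero => exact ⟨by simp [pstate], by simp [pstate], by simp [pstate]⟩
  | succ t ih => exact ih.step hR _

/-- As long as there is one trial for each non-edge, an accepted path is used. -/
theorem pstate_busy (hR : ∀ u v, R u v → R v u) (t : ℕ) (hL : ∀ t' < t, L t' = 1) (w x : ℕ)
    (h : (pstate N R L y t).busy w x) : ∃ z, (pstate N R L y t).out x z = some w := by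
  induction t with
  | zero => simp [pstate] at h
  | succ t ih =>
    have hs := pstate_good (N := N) (L := L) (y := y) hR t
    rcases h with h | ⟨z, h⟩
    · obtain ⟨z, hz⟩ := ih (fun t' ht' => hL t' (by omega)) h
      exact ⟨z, by rw [pstate, PState.step]; simp [newOut, hz]⟩
    · have hn := (mateAt_prop hR hs h).2.2.2.2.2.2.2.2
      -- A non-edge with a single trial can be accepted by one middle node only, so taking the
      -- infimum in `newOut` discards nothing. With several trials, a node could remain busy for a
      -- discarded path.
      have hc : ∀ c, mateAt N R (L t) (pstate N R L y t) (y t) c x z →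
          c = if x < z then y t x z 0 else y t z x 0 := by
        rw [hL t (by omega)]
        rintro c (⟨⟨-, ⟨h, -, -, -, l, hl, e⟩, -⟩, -⟩ | ⟨⟨-, ⟨h, -, -, -, l, hl, e⟩, -⟩, -⟩)
        · obtain rfl : l = 0 := by omega
          simp [h, e]
        · obtain rfl : l = 0 := by omega
          simp [h.not_gt, e]
      refine ⟨z, ?_⟩
      have hex : ∃ c, mateAt N R (L t) (pstate N R L y t) (y t) c x z := ⟨w, h⟩
      have hm := Nat.sInf_mem (s := {c | mateAt N R (L t) (pstate N R L y t) (y t) c x z}) hex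
      rw [pstate, PState.step]
      simp only [newOut, hn, if_true, hex]
      rw [hc _ hm, hc _ h]

theorem pstate_out_none_of_le {t t' : ℕ} (htt : t ≤ t') {u v : ℕ}
    (h : (pstate N R L y t').out u v = none) : (pstate N R L y t).out u v = none := by
  induction t', htt using Nat.le_induction with
  | base => exact h
  | succ t' _ ih =>
    exact ih (PState.step_out_eq_none_iff.1 h).1

/-- The colours that fail for the non-edge `{u, v}`, `u < v`. -/
noncomputable def badColors (N : ℕ) (R : ℕ → ℕ → Prop) (L : ℕ) (s : PState) (y : ℕ → ℕ → ℕ → ℕ)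
    (u v : ℕ) : Finset ℕ :=
  (range N).filter fun c => ¬ R c u ∨ ¬ R c v ∨ s.busy c u ∨ s.busy c v ∨
    (∃ v' < v, Wants N u (R u) (s.out u) L (y u) c v') ∨
    ∃ u' < u, Wants N u' (R u') (s.out u') L (y u') c u ∨ Wants N u' (R u') (s.out u') L (y u') c v

/-- A colour outside `badColors` is requested by `u` and accepted. The set is an overestimate: it
counts what smaller pairs want, whether or not they actually request it or succeed. This is what
makes it depend on smaller pairs only. -/
theorem mem_badColors_of_out_none {L : ℕ} {s : PState} {y : ℕ → ℕ → ℕ → ℕ} {u v l : ℕ}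
    (huv : u < v) (hv : v < N) (hnR : ¬ R u v) (hl : l < L) (hy : y u v l < N)
    (h : (s.step N R L y).out u v = none) : y u v l ∈ badColors N R L s y u v := by
  obtain ⟨h1, h2⟩ := PState.step_out_eq_none_iff.1 h
  by_contra hc
  simp only [badColors, mem_filter, mem_range, hy, true_and, not_or, not_not, not_exists,
    not_and] at hc
  obtain ⟨c1, c2, c3, c4, c5, c6⟩ := hc
  refine h2 (y u v l) (Or.inl ⟨⟨c1, ⟨huv, hv, hnR, h1, l, hl, rfl⟩, c5⟩, c2, c3, c4, ?_⟩)
  rintro u' hu' v' ⟨-, hw, -⟩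
  exact ⟨fun e => (c6 u' hu').1 (e ▸ hw), fun e => (c6 u' hu').2 (e ▸ hw)⟩

/-- The other trials of the same pair `{u, v}` do not matter either, so the `L` trials of one pair
can be treated as successive independent attempts. -/
theorem badColors_congr {L : ℕ} {s : PState} {y y' : ℕ → ℕ → ℕ → ℕ} {u v : ℕ}
    (h : ∀ u' v', u' < v' → v' < N → (u' < u ∨ u' = u ∧ v' < v) → ∀ l < L, y u' v' l = y' u' v' l) :
    badColors N R L s y u v = badColors N R L s y' u v := by
  unfold badColors
  refine Finset.filter_congr fun c _ => ?_
  refine or_congr_right <| or_congr_right <| or_congr_right <| or_congr_right <| or_congr ?_ ?_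
  · refine exists_congr fun v' => and_congr_right fun hv' => wants_congr fun h1 h2 => ?_
    exact h _ _ h1 h2 (Or.inr ⟨rfl, hv'⟩)
  · refine exists_congr fun u' => and_congr_right fun hu' => or_congr ?_ ?_ <;>
    exact wants_congr fun h1 h2 => h _ _ h1 h2 (Or.inl hu')

/-- The other ends of the uncoloured non-edges at `x`. -/
noncomputable def uncolored (N : ℕ) (R : ℕ → ℕ → Prop) (s : PState) (x : ℕ) : Finset ℕ :=
  (range N).filter fun z => z ≠ x ∧ ¬ R x z ∧ s.out x z = none

/-- Bad colours lie in six sets of size at most `N / 8`: for each of the two ends, its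
non-neighbours, the colours of its coloured non-edges (by `hbusy`, these are all the middle nodes
serving it), and the colours tried for its uncoloured ones. -/
theorem four_mul_card_badColors_le (hR : ∀ u v, R u v → R v u) {D L : ℕ} {s : PState}
    {y : ℕ → ℕ → ℕ → ℕ} (hs : s.Good N R)
    (hbusy : ∀ w x, s.busy w x → ∃ z, s.out x z = some w) (hD : 8 * D ≤ N)
    (hdeg : ∀ x < N, ((range N).filter fun z => ¬ R x z).card ≤ D)
    (hL : ∀ x < N, 8 * (L * (uncolored N R s x).card) ≤ N) {u v : ℕ} (hu : u < v) (hv : v < N) :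
    4 * (badColors N R L s y u v).card ≤ 3 * N := by
  let nonnb : ℕ → Finset ℕ := fun x => (range N).filter fun z => ¬ R x z
  let used : ℕ → Finset ℕ := fun x => (nonnb x).image fun z => (s.out x z).getD 0
  let tried : ℕ → Finset ℕ := fun x =>
    (uncolored N R s x ×ˢ range L).image fun p => y (min x p.1) (max x p.1) p.2
  have hused : ∀ x < N, (used x).card ≤ D := fun x hx => card_image_le.trans (hdeg x hx)
  have htried : ∀ x < N, 8 * (tried x).card ≤ N := fun x hx => by
    have : (tried x).card ≤ (uncolored N R s x).card * L := by
      simpa using card_image_le (s := uncolored N R s x ×ˢ range L)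
        (f := fun p => y (min x p.1) (max x p.1) p.2)
    have := hL x hx
    rw [mul_comm L] at this
    omega
  have hb : ∀ c x, s.busy c x → c ∈ used x := fun c x h => by
    obtain ⟨z, hz⟩ := hbusy c x h
    have hp := hs.path _ _ _ hz
    exact mem_image.2 ⟨z, mem_filter.2 ⟨mem_range.2 hp.2.2.2.2.2.1, hp.2.2.1⟩, by simp [hz]⟩
  have ht : ∀ c a b, a < b → Wants N a (R a) (s.out a) L (y a) c b → c ∈ tried a ∧ c ∈ tried b := by
    rintro c a b hab ⟨-, h2, h3, h4, l, hl, rfl⟩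
    constructor
    · refine mem_image.2 ⟨(b, l), mem_product.2 ⟨mem_filter.2 ⟨mem_range.2 h2, hab.ne', h3, h4⟩,
        mem_range.2 hl⟩, ?_⟩
      simp [min_eq_left hab.le, max_eq_right hab.le]
    · refine mem_image.2 ⟨(a, l), mem_product.2 ⟨mem_filter.2 ⟨mem_range.2 (hab.trans h2), hab.ne,
        fun h => h3 (hR _ _ h), hs.symm a b ▸ h4⟩, mem_range.2 hl⟩, ?_⟩
      simp [min_eq_right hab.le, max_eq_left hab.le]
  have hsub : badColors N R L s y u v ⊆
      (nonnb u ∪ nonnb v) ∪ (used u ∪ used v) ∪ (tried u ∪ tried v) := by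
    intro c hc
    obtain ⟨hcN, hc⟩ := mem_filter.1 hc
    simp only [mem_union]
    rcases hc with h | h | h | h | ⟨v', hv', h⟩ | ⟨u', hu', h | h⟩
    · exact Or.inl (Or.inl (Or.inl (mem_filter.2 ⟨hcN, fun h' => h (hR _ _ h')⟩)))
    · exact Or.inl (Or.inl (Or.inr (mem_filter.2 ⟨hcN, fun h' => h (hR _ _ h')⟩)))
    · exact Or.inl (Or.inr (Or.inl (hb _ _ h)))
    · exact Or.inl (Or.inr (Or.inr (hb _ _ h)))
    · exact Or.inr (Or.inl (ht _ _ _ h.1 h).1)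
    · exact Or.inr (Or.inl (ht _ _ _ h.1 h).2)
    · exact Or.inr (Or.inr (ht _ _ _ h.1 h).2)
  have huN := hu.trans hv
  have c0 := card_le_card hsub
  have c1 := card_union_le ((nonnb u ∪ nonnb v) ∪ (used u ∪ used v)) (tried u ∪ tried v)
  have c2 := card_union_le (nonnb u ∪ nonnb v) (used u ∪ used v)
  have c3 := card_union_le (nonnb u) (nonnb v)
  have c4 := card_union_le (used u) (used v)
  have c5 := card_union_le (tried u) (tried v)
  have d1 : (nonnb u).card ≤ D := hdeg u huN
  have d2 : (nonnb v).card ≤ D := hdeg v hv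
  have d3 := hused u huN
  have d4 := hused v hv
  have d5 := htried u huN
  have d6 := htried v hv
  omega

/-! ### The process with independent uniform trials -/

section Random

variable {ι α : Type*} [DecidableEq ι]

/-- The colours tried, as read off from the coordinates `κ (t, u, v, l)` of `ω`. -/
def choices (N : ℕ) (val : α → ℕ) (κ : ℕ × ℕ × ℕ × ℕ → ι) (ω : ι → α) (t u v l : ℕ) : ℕ :=
  val (ω (κ (t, u, v, l))) % N

/-- The trials `(t, u, v, l)` that may occur up to phase `T`. -/
def trialBox (N T : ℕ) (L : ℕ → ℕ) : Set (ℕ × ℕ × ℕ × ℕ) :=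
  {p | p.1 ≤ T ∧ p.2.1 < p.2.2.1 ∧ p.2.2.1 < N ∧ p.2.2.2 < L p.1}

variable {N T : ℕ} {R : ℕ → ℕ → Prop} {L : ℕ → ℕ} {val : α → ℕ} {κ : ℕ × ℕ × ℕ × ℕ → ι}

/-- The failing colours of a trial. -/
noncomputable def trialBad (N : ℕ) (R : ℕ → ℕ → Prop) (L : ℕ → ℕ) (y : ℕ → ℕ → ℕ → ℕ → ℕ)
    (p : ℕ × ℕ × ℕ × ℕ) : Finset ℕ :=
  badColors N R (L p.1) (pstate N R L y p.1) (y p.1) p.2.1 p.2.2.1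

/-- The order is lexicographic in phase and pair and ignores the trial number, so trials of the same
pair in the same phase are mutually invisible. -/
theorem trialBad_update (hκ : Set.InjOn κ (trialBox N T L)) {p q : ℕ × ℕ × ℕ × ℕ}
    (hp : p ∈ trialBox N T L) (hq : q ∈ trialBox N T L)
    (hpq : toLex (p.1, toLex (p.2.1, p.2.2.1)) ≤ toLex (q.1, toLex (q.2.1, q.2.2.1)))
    (ω : ι → α) (a : α) :
    trialBad N R L (choices N val κ (Function.update ω (κ q) a)) p
      = trialBad N R L (choices N val κ ω) p := by
  have key : ∀ p' ∈ trialBox N T L, p' ≠ q →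
      choices N val κ (Function.update ω (κ q) a) p'.1 p'.2.1 p'.2.2.1 p'.2.2.2
        = choices N val κ ω p'.1 p'.2.1 p'.2.2.1 p'.2.2.2 := by
    intro p' hp' hne
    have : κ p' ≠ κ q := fun h => hne (hκ hp' hq h)
    simp [choices, this]
  obtain ⟨t, u, v, l⟩ := p
  obtain ⟨t₁, u₁, v₁, l₁⟩ := q
  obtain ⟨h1, h2, h3, h4⟩ := hp
  simp only [Prod.Lex.toLex_le_toLex] at hpq h1 h2 h3 h4
  simp only [trialBad]
  rw [pstate_congr (y := choices N val κ (Function.update ω (κ (t₁, u₁, v₁, l₁)) a))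
    (y' := choices N val κ ω) t]
  · refine badColors_congr fun u' v' ha hb hc l' hl' => ?_
    refine key (t, u', v', l') ⟨h1, ha, hb, hl'⟩ ?_
    rintro ⟨⟩
    omega
  · intro t' ht' u' v' ha hb l' hl'
    refine key (t', u', v', l') ⟨by dsimp only; omega, ha, hb, hl'⟩ ?_
    rintro ⟨⟩
    omega

variable [Fintype ι] [Fintype α] [Nonempty α]

/-- The trials in `S` all fail, with few failing colours each, with probability at most
`(3 / 4) ^ #S`. -/
theorem card_trials_fail_le (hN : 0 < N) (hκ : Set.InjOn κ (trialBox N T L))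
    (hval : ∀ B : Finset ℕ, (univ.filter fun a => val a % N ∈ B).card * N ≤ B.card * Fintype.card α)
    (S : Finset (ℕ × ℕ × ℕ × ℕ)) (hS : ∀ p ∈ S, p ∈ trialBox N T L) (E : Finset (ι → α))
    (hE : ∀ ω ∈ E, ∀ p ∈ S, 4 * (trialBad N R L (choices N val κ ω) p).card ≤ 3 * N ∧
      choices N val κ ω p.1 p.2.1 p.2.2.1 p.2.2.2 ∈ trialBad N R L (choices N val κ ω) p) :
    (E.card : ℝ) ≤ (3 / 4) ^ S.card * Fintype.card (ι → α) := by
  -- Emptying the set where it is too large makes the density bound hold for every `ω`; on `E`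
  -- nothing is lost.
  let bad : ℕ × ℕ × ℕ × ℕ → (ι → α) → Finset α := fun p ω =>
    if 4 * (trialBad N R L (choices N val κ ω) p).card ≤ 3 * N then
      univ.filter fun a => val a % N ∈ trialBad N R L (choices N val κ ω) p else ∅
  refine le_trans ?_ (card_all_fail_le (β := ℕ ×ₗ (ℕ ×ₗ ℕ))
    (fun p => toLex (p.1, toLex (p.2.1, p.2.2.1))) κ bad (3 / 4) (by norm_num) S
    (hκ.mono fun p hp => hS p hp) ?_ ?_)
  · refine Nat.cast_le.2 (card_le_card fun ω hω => ?_)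
    simp only [mem_filter, mem_univ, true_and]
    intro p hp
    obtain ⟨h1, h2⟩ := hE ω hω p hp
    simp only [bad, if_pos h1, mem_filter, mem_univ, true_and]
    exact h2
  · intro i hi j hj hij ω a
    simp only [bad, trialBad_update hκ (hS i hi) (hS j hj) hij]
  · intro p _ ω
    simp only [bad]
    split_ifs with h
    · have h1 := hval (trialBad N R L (choices N val κ ω) p)
      have h2 : (univ.filter fun a => val a % N ∈ trialBad N R L (choices N val κ ω) p).card * N * 4
          ≤ 3 * Fintype.card α * N := by
        calc _ ≤ (trialBad N R L (choices N val κ ω) p).card * Fintype.card α * 4 :=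
              Nat.mul_le_mul_right _ h1
          _ = 4 * (trialBad N R L (choices N val κ ω) p).card * Fintype.card α := by ring
          _ ≤ 3 * N * Fintype.card α := Nat.mul_le_mul_right _ h
          _ = _ := by ring
      have h3 : (univ.filter fun a => val a % N ∈ trialBad N R L (choices N val κ ω) p).card * 4
          ≤ 3 * Fintype.card α := by
        refine Nat.le_of_mul_le_mul_right ?_ hN
        linarith
      have h4 : ((univ.filter fun a => val a % N ∈ trialBad N R L (choices N val κ ω) p).card : ℝ) * 4
          ≤ 3 * Fintype.card α := by exact_mod_cast h3
      linarith
    · simp only [card_empty, Nat.cast_zero]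
      positivity

/-- Many non-edges at `x` all stay uncoloured only with small probability. -/
theorem card_uncolored_superset_le (hN : 0 < N) (hR : ∀ u v, R u v → R v u)
    (hκ : Set.InjOn κ (trialBox N T L))
    (hval : ∀ B : Finset ℕ, (univ.filter fun a => val a % N ∈ B).card * N ≤ B.card * Fintype.card α)
    (hL : ∀ t < T, L t = 1) {D : ℕ} (hD : 8 * D ≤ N)
    (hdeg : ∀ x < N, ((range N).filter fun z => ¬ R x z).card ≤ D) {x : ℕ} (hx : x < N)
    (S : Finset ℕ) :
    ((univ.filter fun ω : ι → α =>
        S ⊆ uncolored N R (pstate N R L (choices N val κ ω) T) x).card : ℝ)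
      ≤ (3 / 4) ^ (T * S.card) * Fintype.card (ι → α) := by
  by_cases hS : ∀ z ∈ S, z < N ∧ z ≠ x ∧ ¬ R x z
  swap
  · have : (univ.filter fun ω : ι → α =>
        S ⊆ uncolored N R (pstate N R L (choices N val κ ω) T) x) = ∅ := by
      refine filter_eq_empty_iff.2 fun ω _ h => hS fun z hz => ?_
      have := mem_filter.1 (h hz)
      exact ⟨mem_range.1 this.1, this.2.1, this.2.2.1⟩
    rw [this]
    simp only [card_empty, Nat.cast_zero]
    positivity
  -- The smaller label owns the trials of a pair. One trial in each of the `T` phases for each `z ∈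
  -- S` gives `T * #S` failures.
  let f : ℕ × ℕ → ℕ × ℕ × ℕ × ℕ := fun p => (p.1, min x p.2, max x p.2, 0)
  have hf : Function.Injective f := by
    rintro ⟨t, z⟩ ⟨t', z'⟩ h
    simp only [f, Prod.mk.injEq] at h ⊢
    omega
  have hcard : ((range T ×ˢ S).image f).card = T * S.card := by
    rw [card_image_of_injective _ hf, card_product, card_range]
  rw [← hcard]
  refine card_trials_fail_le hN hκ hval (R := R) _ ?_ _ ?_
  · intro p hp
    obtain ⟨⟨t, z⟩, htz, rfl⟩ := mem_image.1 hp
    obtain ⟨ht, hz⟩ := mem_product.1 htz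
    have := hS z hz
    have ht' := mem_range.1 ht
    simp only [trialBox, f, Set.mem_ofPred_eq, hL t ht']
    dsimp only at ht' this
    omega
  · intro ω hω p hp
    obtain ⟨⟨t, z⟩, htz, rfl⟩ := mem_image.1 hp
    obtain ⟨ht, hz⟩ := mem_product.1 htz
    have ht := mem_range.1 ht
    dsimp only at ht hz
    obtain ⟨hzN, hzx, hzR⟩ := hS z hz
    have hout : (pstate N R L (choices N val κ ω) (t + 1)).out x z = none :=
      pstate_out_none_of_le ht (mem_filter.1 ((mem_filter.1 hω).2 hz)).2.2.2
    have hgood := pstate_good (N := N) (L := L) (y := choices N val κ ω) hR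
    have hlt : min x z < max x z := by omega
    have hmax : max x z < N := by omega
    have hnR : ¬ R (min x z) (max x z) ∧
        (pstate N R L (choices N val κ ω) (t + 1)).out (min x z) (max x z) = none := by
      rcases le_total x z with h | h
      · rw [min_eq_left h, max_eq_right h]; exact ⟨hzR, hout⟩
      · rw [min_eq_right h, max_eq_left h]
        exact ⟨fun h => hzR (hR _ _ h), (hgood _).symm z x ▸ hout⟩
    refine ⟨four_mul_card_badColors_le hR (hgood t)
      (pstate_busy hR t fun t' ht' => hL t' (by omega)) hD hdeg ?_ hlt hmax, ?_⟩
    · intro x hx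
      -- With one trial per non-edge, the complement degree already bounds the number of colours
      -- tried at a node.
      have : (uncolored N R (pstate N R L (choices N val κ ω) t) x).card ≤ D :=
        (card_le_card fun z hz => by
          have := mem_filter.1 hz
          exact mem_filter.2 ⟨this.1, this.2.2.1⟩).trans (hdeg x hx)
      simp only [f, hL t ht]
      omega
    · exact mem_badColors_of_out_none hlt hmax hnR.1 (by simp [f, hL t ht]) (Nat.mod_lt _ hN) hnR.2

/-- The last phase, with `L T` trials for each non-edge. -/
theorem card_last_phase_fail_le (hN : 0 < N) (hR : ∀ u v, R u v → R v u)
    (hκ : Set.InjOn κ (trialBox N T L))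
    (hval : ∀ B : Finset ℕ, (univ.filter fun a => val a % N ∈ B).card * N ≤ B.card * Fintype.card α)
    (hL : ∀ t < T, L t = 1) {D : ℕ} (hD : 8 * D ≤ N)
    (hdeg : ∀ x < N, ((range N).filter fun z => ¬ R x z).card ≤ D) {u v : ℕ} (huv : u < v)
    (hv : v < N) (hnR : ¬ R u v) :
    ((univ.filter fun ω : ι → α =>
        (∀ x < N, 8 * (L T * (uncolored N R (pstate N R L (choices N val κ ω) T) x).card) ≤ N) ∧
          (pstate N R L (choices N val κ ω) (T + 1)).out u v = none).card : ℝ)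
      ≤ (3 / 4) ^ (L T) * Fintype.card (ι → α) := by
  have hcard : ((range (L T)).image fun l => (T, u, v, l)).card = L T := by
    rw [card_image_of_injective _ (fun l l' h => by simpa using h), card_range]
  conv_rhs => rw [← hcard]
  refine card_trials_fail_le hN hκ hval (R := R) _ ?_ _ ?_
  · intro p hp
    obtain ⟨l, hl, rfl⟩ := mem_image.1 hp
    exact ⟨le_rfl, huv, hv, mem_range.1 hl⟩
  · intro ω hω p hp
    obtain ⟨l, hl, rfl⟩ := mem_image.1 hp
    obtain ⟨-, h1, h2⟩ := mem_filter.1 hω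
    exact ⟨four_mul_card_badColors_le hR (pstate_good hR T) (pstate_busy hR T hL) hD hdeg h1 huv hv,
      mem_badColors_of_out_none huv hv hnR (mem_range.1 hl) (Nat.mod_lt _ hN) h2⟩

/-- The probability that the process leaves a non-edge uncoloured. -/
theorem card_process_fail_le (hN : 0 < N) (hR : ∀ u v, R u v → R v u)
    (hκ : Set.InjOn κ (trialBox N T L))
    (hval : ∀ B : Finset ℕ, (univ.filter fun a => val a % N ∈ B).card * N ≤ B.card * Fintype.card α)
    (hL : ∀ t < T, L t = 1) {D : ℕ} (hD : 8 * D ≤ N)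
    (hdeg : ∀ x < N, ((range N).filter fun z => ¬ R x z).card ≤ D)
    {r : ℕ} (hr : ∀ m < r, 8 * (L T * m) ≤ N) :
    ((univ.filter fun ω : ι → α => ∃ u v, u < v ∧ v < N ∧ ¬ R u v ∧
        (pstate N R L (choices N val κ ω) (T + 1)).out u v = none).card : ℝ)
      ≤ (N * (D.choose r * (3 / 4) ^ (T * r)) + N ^ 2 * (3 / 4) ^ (L T))
        * Fintype.card (ι → α) := by
  let nonnb : ℕ → Finset ℕ := fun x => (range N).filter fun z => ¬ R x z
  let E₁ : ℕ → Finset ℕ → Finset (ι → α) := fun x S => univ.filter fun ω =>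
    S ⊆ uncolored N R (pstate N R L (choices N val κ ω) T) x
  let E₂ : ℕ × ℕ → Finset (ι → α) := fun p => univ.filter fun ω =>
    (∀ x < N, 8 * (L T * (uncolored N R (pstate N R L (choices N val κ ω) T) x).card) ≤ N) ∧
      (pstate N R L (choices N val κ ω) (T + 1)).out p.1 p.2 = none
  let P : Finset (ℕ × ℕ) := (range N ×ˢ range N).filter fun p => p.1 < p.2 ∧ ¬ R p.1 p.2
  have hsub : (univ.filter fun ω : ι → α => ∃ u v, u < v ∧ v < N ∧ ¬ R u v ∧
        (pstate N R L (choices N val κ ω) (T + 1)).out u v = none) ⊆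
      ((range N).biUnion fun x => (powersetCard r (nonnb x)).biUnion (E₁ x)) ∪ P.biUnion E₂ := by
    intro ω hω
    obtain ⟨-, u, v, huv, hv, hnR, hout⟩ := mem_filter.1 hω
    -- Either the last phase starts with small uncoloured degrees and fails for some pair, or some
    -- node already has `r` uncoloured non-edges.
    by_cases h : ∀ x < N, (uncolored N R (pstate N R L (choices N val κ ω) T) x).card < r
    · refine mem_union_right _ (mem_biUnion.2 ⟨(u, v), ?_, ?_⟩)
      · exact mem_filter.2 ⟨mem_product.2 ⟨mem_range.2 (huv.trans hv), mem_range.2 hv⟩, huv, hnR⟩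
      · exact mem_filter.2 ⟨mem_univ _, fun x hx => hr _ (h x hx), hout⟩
    · push Not at h
      obtain ⟨x, hx, hrx⟩ := h
      obtain ⟨S, hS, hSr⟩ := exists_subset_card_eq hrx
      refine mem_union_left _ (mem_biUnion.2 ⟨x, mem_range.2 hx, mem_biUnion.2 ⟨S, ?_, ?_⟩⟩)
      · refine mem_powersetCard.2 ⟨fun z hz => ?_, hSr⟩
        have := mem_filter.1 (hS hz)
        exact mem_filter.2 ⟨this.1, this.2.2.1⟩
      · exact mem_filter.2 ⟨mem_univ _, hS⟩
  set W : ℝ := ((Fintype.card (ι → α) : ℕ) : ℝ) with hW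
  have hW0 : 0 ≤ W := Nat.cast_nonneg _
  have h1 : ∀ x ∈ range N, ((((powersetCard r (nonnb x)).biUnion (E₁ x)).card : ℕ) : ℝ)
      ≤ D.choose r * (3 / 4) ^ (T * r) * W := by
    intro x hx
    have hx := mem_range.1 hx
    calc ((((powersetCard r (nonnb x)).biUnion (E₁ x)).card : ℕ) : ℝ)
        ≤ ∑ S ∈ powersetCard r (nonnb x), ((E₁ x S).card : ℝ) := by exact_mod_cast card_biUnion_le
      _ ≤ ∑ S ∈ powersetCard r (nonnb x), (3 / 4) ^ (T * r) * W := by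
          refine sum_le_sum fun S hS => ?_
          rw [← (mem_powersetCard.1 hS).2]
          exact card_uncolored_superset_le hN hR hκ hval hL hD hdeg hx S
      _ = ((nonnb x).card.choose r : ℕ) * ((3 / 4) ^ (T * r) * W) := by
          rw [sum_const, card_powersetCard, nsmul_eq_mul]
      _ ≤ (D.choose r : ℕ) * ((3 / 4) ^ (T * r) * W) := by
          gcongr
          exact hdeg x hx
      _ = _ := by ring
  have h2 : ∀ p ∈ P, ((E₂ p).card : ℝ) ≤ (3 / 4) ^ (L T) * W := by
    intro p hp
    obtain ⟨hp1, hp2, hp3⟩ := mem_filter.1 hp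
    exact card_last_phase_fail_le hN hR hκ hval hL hD hdeg hp2
      (mem_range.1 (mem_product.1 hp1).2) hp3
  have hP : (P.card : ℝ) ≤ N ^ 2 := by
    have : P.card ≤ N * N := by
      simpa using card_filter_le (range N ×ˢ range N) fun p => p.1 < p.2 ∧ ¬ R p.1 p.2
    rw [sq]
    exact_mod_cast this
  calc _ ≤ ((((range N).biUnion fun x => (powersetCard r (nonnb x)).biUnion (E₁ x)).card : ℕ) : ℝ)
        + ((P.biUnion E₂).card : ℕ) := by
        exact_mod_cast (card_le_card hsub).trans (card_union_le _ _)
    _ ≤ (∑ x ∈ range N, D.choose r * (3 / 4) ^ (T * r) * W) + ∑ p ∈ P, (3 / 4) ^ (L T) * W := by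
        refine add_le_add (le_trans ?_ (sum_le_sum h1)) (le_trans ?_ (sum_le_sum h2)) <;>
        exact_mod_cast card_biUnion_le
    _ = N * (D.choose r * (3 / 4) ^ (T * r) * W) + P.card * ((3 / 4) ^ (L T) * W) := by
        simp
    _ ≤ N * (D.choose r * (3 / 4) ^ (T * r) * W) + N ^ 2 * ((3 / 4) ^ (L T) * W) := by gcongr
    _ = _ := by ring

end Random

/-! ### Algorithms whose messages are natural numbers -/

/-- Node code with a round counter and natural numbers as messages; `send t s i` is the message to
the node with ID `i` in round `t`, and `recv t s m` processes the messages `m i` from the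
neighbours with ID `i` (`m i = 0` if there is no such neighbour). -/
structure Code (In Out : Type) where
  Seed : Type
  [seedFintype : Fintype Seed]
  [seedNonempty : Nonempty Seed]
  State : Type
  init : ℕ → Finset ℕ → In → Seed → State
  send : ℕ → State → ℕ → ℕ
  recv : ℕ → State → (ℕ → ℕ) → State
  output : State → Out

attribute [instance] Code.seedFintype Code.seedNonempty

/-- Bit strings of length `b` as numbers below `2 ^ b`. -/
noncomputable def bitsEquiv (b : ℕ) : (Fin b → Bool) ≃ Fin (2 ^ b) :=
  Fintype.equivFinOfCardEq (by simp)

/-- The messages of a round, by the ID of the sender. -/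
noncomputable def inboxOf {b : ℕ} (M : Finset (ℕ × (Fin b → Bool))) (i : ℕ) : ℕ :=
  if h : ∃ m, (i, m) ∈ M then (bitsEquiv b h.choose).val else 0

theorem inboxOf_eq {b : ℕ} {M : Finset (ℕ × (Fin b → Bool))} {i : ℕ} {m : Fin b → Bool}
    (h : ∀ m', (i, m') ∈ M ↔ m' = m) : inboxOf M i = bitsEquiv b m := by
  have hex : ∃ m, (i, m) ∈ M := ⟨m, (h m).2 rfl⟩
  rw [inboxOf, dif_pos hex, (h _).1 hex.choose_spec]

theorem inboxOf_eq_zero {b : ℕ} {M : Finset (ℕ × (Fin b → Bool))} {i : ℕ}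
    (h : ∀ m, (i, m) ∉ M) : inboxOf M i = 0 := by
  rw [inboxOf, dif_neg (by simpa using h)]

namespace Code

variable {In Out V : Type}

/-- The code as an algorithm with messages of `bits` bits. -/
noncomputable abbrev toCongest (c : Code In Out) (bits rounds : ℕ) : CongestAlgorithm In Out where
  Seed := c.Seed
  State := ℕ × c.State
  msgBits := bits
  rounds := rounds
  init i nb inp s := (0, c.init i nb inp s)
  send s i := (bitsEquiv bits).symm (Fin.ofNat (2 ^ bits) (c.send s.1 s.2 i))
  recv s M := (s.1 + 1, c.recv s.1 s.2 (inboxOf M))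
  output s := c.output s.2

/-- The messages received by `v` when the senders are in the states `S`. -/
noncomputable def inbox (c : Code In Out) (bits : ℕ) (G : SimpleGraph V) (id : V ↪ ℕ) (t : ℕ)
    (S : V → c.State) (v : V) (i : ℕ) : ℕ :=
  if h : ∃ u, G.Adj v u ∧ id u = i then c.send t (S h.choose) (id v) % 2 ^ bits else 0

theorem inbox_eq (c : Code In Out) (bits : ℕ) (G : SimpleGraph V) (id : V ↪ ℕ) (t : ℕ)
    (S : V → c.State) {v u : V} (h : G.Adj v u) :
    c.inbox bits G id t S v (id u) = c.send t (S u) (id v) % 2 ^ bits := by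
  have hex : ∃ u', G.Adj v u' ∧ id u' = id u := ⟨u, h, rfl⟩
  rw [inbox, dif_pos hex, id.injective hex.choose_spec.2]

variable [Fintype V]

/-- The states of the nodes after `t` rounds. -/
noncomputable def exec (c : Code In Out) (bits : ℕ) (G : SimpleGraph V) [DecidableRel G.Adj]
    (id : V ↪ ℕ) (input : V → In) (ω : V → c.Seed) : ℕ → V → c.State
  | 0, v => c.init (id v) ((G.neighborFinset v).map id) (input v) (ω v)
  | t + 1, v => c.recv t (c.exec bits G id input ω t v)
      (c.inbox bits G id t (c.exec bits G id input ω t) v)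

theorem stateAt_toCongest (c : Code In Out) (bits rounds : ℕ) (G : SimpleGraph V)
    [DecidableRel G.Adj] (id : V ↪ ℕ) (input : V → In) (ω : V → c.Seed) (t : ℕ) (v : V) :
    (c.toCongest bits rounds).stateAt G id input ω t v = (t, c.exec bits G id input ω t v) := by
  induction t generalizing v with
  | zero => rfl
  | succ t ih =>
    rw [CongestAlgorithm.stateAt.eq_def, exec]
    simp only [ih]
    refine Prod.ext rfl ?_
    change c.recv t _ _ = c.recv t _ _
    congr 1
    funext i
    by_cases h : ∃ u, G.Adj v u ∧ id u = i
    · obtain ⟨u, hu, rfl⟩ := h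
      rw [inbox_eq _ _ _ _ _ _ hu]
      rw [inboxOf_eq (m := (c.toCongest bits rounds).send
        (t, c.exec bits G id input ω t u) (id v))]
      · simp [toCongest]
      · intro m'
        simp only [mem_image, SimpleGraph.mem_neighborFinset, Prod.mk.injEq]
        constructor
        · rintro ⟨u', -, h1, rfl⟩
          rw [id.injective h1]
        · rintro rfl
          exact ⟨u, hu, rfl, rfl⟩
    · rw [inbox, dif_neg h, inboxOf_eq_zero]
      intro m hm
      obtain ⟨u, hu, he⟩ := mem_image.1 hm
      exact h ⟨u, (G.mem_neighborFinset v u).1 hu, (Prod.mk.inj he).1⟩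

theorem run_toCongest (c : Code In Out) (bits rounds : ℕ) (G : SimpleGraph V)
    [DecidableRel G.Adj] (id : V ↪ ℕ) (input : V → In) (ω : V → c.Seed) (v : V) :
    (c.toCongest bits rounds).run G id input ω v
      = c.output (c.exec bits G id input ω rounds v) :=
  congrArg (fun s : ℕ × c.State => c.output s.2)
    (stateAt_toCongest c bits rounds G id input ω rounds v)

end Code

/-! ### The code of a node -/

/-- The memory of a node. The fields `cn` (IDs of the neighbours in its almost-clique), `lab` and
`labs` (labels of the node and of these neighbours), `size` (size of the almost-clique) are
computed by the first rounds, with the help of the fields from `leader` to `size₀`. The remaining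
fields are those of the colouring process: `out` and `busy` are in terms of labels, `known y p`
says that `p` is the ID of the node with label `y`, and `pend` holds outgoing answers. -/
structure Node where
  nbr : Finset ℕ
  ac : ℕ
  lead : ℕ
  seed : ℕ → ℕ → ℕ → ℕ
  cn : Finset ℕ
  leader : ℕ
  adjL : ℕ
  home : ℕ
  kids : Finset ℕ
  cnt : ℕ → ℕ
  base : ℕ
  size₀ : ℕ
  size : ℕ
  lab : ℕ
  labs : ℕ → ℕ
  out : ℕ → Option ℕ
  busy : ℕ → Prop
  known : ℕ → ℕ → Prop
  pend : ℕ → ℕ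

namespace Node

/-- Adjacency to the node with a given label. -/
def nb (s : Node) (c : ℕ) : Prop := ∃ i ∈ s.cn, s.labs i = c

/-- The request to the neighbour with ID `i`, plus one; `0` if there is none. -/
noncomputable def request (s : Node) (L : ℕ → ℕ) (t i : ℕ) : ℕ :=
  if ∃ v, Requests s.size s.lab s.nb s.out (L t) (fun v l => s.seed t v l % s.size) (s.labs i) v
  then sInf {v | Requests s.size s.lab s.nb s.out (L t) (fun v l => s.seed t v l % s.size)
    (s.labs i) v} + 1
  else 0

/-- The messages of a node. -/
noncomputable def send (L : ℕ → ℕ) : ℕ → Node → ℕ → ℕ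
  | 0, s, _ => Nat.pair s.ac s.lead
  | 1, s, _ => s.adjL
  | 2, s, i => if i = s.home then 1 else 0
  | 3, s, _ => s.kids.card
  | 4, s, i => Nat.pair (∑ j ∈ s.cn.filter (· < i), s.cnt j) (∑ j ∈ s.cn, s.cnt j)
  | 5, s, i => Nat.pair (s.base + (s.kids.filter (· < i)).card) s.size₀
  | 6, s, _ => s.lab
  | t + 7, s, i => if t % 2 = 0 then s.request L (t / 2) i else s.pend i

/-- The requests received by a node, in terms of labels. -/
def req (s : Node) (m : ℕ → ℕ) (u v : ℕ) : Prop := ∃ i ∈ s.cn, s.labs i = u ∧ m i = v + 1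

/-- The pairs of labels of nodes that a node connects. -/
def mate (s : Node) (m : ℕ → ℕ) : ℕ → ℕ → Prop := Mates s.nb s.busy (s.req m)

/-- Processing of requests. -/
noncomputable def recvRequests (s : Node) (m : ℕ → ℕ) : Node :=
  { s with
    busy := fun x => s.busy x ∨ ∃ z, s.mate m x z
    pend := fun i => if h : ∃ j ∈ s.cn, s.mate m (s.labs i) (s.labs j)
      then Nat.pair (s.labs h.choose + 1) h.choose else 0 }

/-- Processing of answers. -/
noncomputable def recvAnswers (s : Node) (m : ℕ → ℕ) : Node :=
  { s with
    out := newOut s.out fun y c => ∃ i ∈ s.cn, s.labs i = c ∧ (m i).unpair.1 = y + 1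
    known := fun y p => s.known y p ∨ ∃ i ∈ s.cn, m i = Nat.pair (y + 1) p }

/-- Processing of the messages of a round. -/
noncomputable def recv : ℕ → Node → (ℕ → ℕ) → Node
  | 0, s, m =>
    { s with
      cn := s.nbr.filter fun i => (m i).unpair.1 = s.ac
      leader := sInf {i | i ∈ s.nbr ∧ (m i).unpair.1 = s.ac ∧ (m i).unpair.2 = 1}
      adjL := if ∃ i ∈ s.nbr, (m i).unpair.1 = s.ac ∧ (m i).unpair.2 = 1 then 1 else 0 }
  | 1, s, m => { s with home := sInf {i | i ∈ s.cn ∧ m i = 1} }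
  | 2, s, m => { s with kids := s.cn.filter fun i => m i = 1 }
  | 3, s, m => { s with cnt := m }
  | 4, s, m => { s with base := (m s.leader).unpair.1, size₀ := (m s.leader).unpair.2 }
  | 5, s, m => { s with lab := (m s.home).unpair.1, size := (m s.home).unpair.2 }
  | 6, s, m => { s with labs := m }
  | t + 7, s, m => if t % 2 = 0 then s.recvRequests m else s.recvAnswers m

/-- The output of a node. -/
noncomputable def output (s : Node) (i : ℕ) : Option ℕ :=
  if h : ∃ j ∈ s.cn, ∃ y, s.known y i ∧ s.out y = some (s.labs j) then some h.choose else none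

end Node

/-- The index set of the random numbers of a node: phase, label of the partner, trial. -/
abbrev TrialIndex (n T Lmax : ℕ) : Type := Fin (T + 1) × Fin (n + 1) × Fin (Lmax + 1)

/-- The trial index with given entries. -/
def trialIndex (n T Lmax t v l : ℕ) : TrialIndex n T Lmax :=
  (Fin.ofNat _ t, Fin.ofNat _ v, Fin.ofNat _ l)

/-- The code of a node, for networks with `n` nodes. -/
noncomputable def overlayCode (n T : ℕ) (L : ℕ → ℕ) : Code CliqueInput (ℕ → Option ℕ) where
  Seed := TrialIndex n T (L T) → Fin n.factorial
  seedNonempty := ⟨fun _ => ⟨0, n.factorial_pos⟩⟩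
  State := Node
  init _ nbr inp s :=
    { nbr := nbr
      ac := inp.acId.elim 0 (· + 1)
      lead := if inp.isLeader then 1 else 0
      seed := fun t v l => s (trialIndex n T (L T) t v l)
      cn := ∅, leader := 0, adjL := 0, home := 0, kids := ∅, cnt := 0, base := 0, size₀ := 0
      size := 0, lab := 0, labs := 0, out := fun _ => none, busy := fun _ => False
      known := fun _ _ => False, pend := 0 }
  send := Node.send L
  recv := Node.recv
  output := Node.output

/-! ### The setup rounds: numbering the nodes of a cluster. -/

/-- Ranks in a linear order are the numbers below the cardinality. -/
theorem rank_bijOn {V β : Type*} [LinearOrder β] (C : Finset V) (key : V → β)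
    (hkey : Set.InjOn key C) :
    Set.InjOn (fun x => (C.filter fun z => key z < key x).card) C ∧
      C.image (fun x => (C.filter fun z => key z < key x).card) = range C.card := by
  have hinj : Set.InjOn (fun x => (C.filter fun z => key z < key x).card) C := by
    have hlt : ∀ x ∈ C, ∀ x', key x < key x' →
        (C.filter fun z => key z < key x).card < (C.filter fun z => key z < key x').card := by
      intro x hx x' h
      refine card_lt_card ⟨fun z hz => ?_, fun hs => ?_⟩
      · have := mem_filter.1 hz
        exact mem_filter.2 ⟨this.1, this.2.trans h⟩
      · exact lt_irrefl _ (mem_filter.1 (hs (mem_filter.2 ⟨hx, h⟩))).2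
    intro x hx x' hx' h
    rcases lt_trichotomy (key x) (key x') with h' | h' | h'
    · exact absurd h (hlt x hx x' h').ne
    · exact hkey hx hx' h'
    · exact absurd h (hlt x' hx' x h').ne'
  refine ⟨hinj, eq_of_subset_of_card_le ?_ ?_⟩
  · intro c hc
    obtain ⟨x, hx, rfl⟩ := mem_image.1 hc
    refine mem_range.2 (card_lt_card ⟨filter_subset _ _, fun hs => ?_⟩)
    exact lt_irrefl _ (mem_filter.1 (hs hx)).2
  · rw [card_range, card_image_of_injOn hinj]

section Execution

variable {V : Type} [Fintype V]

/-- The memory of the nodes after `t` rounds. -/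
noncomputable def nodeAt (n T : ℕ) (L : ℕ → ℕ) (bits : ℕ) (G : SimpleGraph V) [DecidableRel G.Adj]
    (id : V ↪ ℕ) (input : V → CliqueInput) (ω : V → TrialIndex n T (L T) → Fin n.factorial) :
    ℕ → V → Node :=
  (overlayCode n T L).exec bits G id input ω

/-- The messages that `v` receives in round `t`. -/
noncomputable def mailAt (n T : ℕ) (L : ℕ → ℕ) (bits : ℕ) (G : SimpleGraph V) [DecidableRel G.Adj]
    (id : V ↪ ℕ) (input : V → CliqueInput) (ω : V → TrialIndex n T (L T) → Fin n.factorial) (t : ℕ)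
    (v : V) : ℕ → ℕ :=
  (overlayCode n T L).inbox bits G id t (nodeAt n T L bits G id input ω t) v

/-- The assumptions on the members of the family that are used by the algorithm. All numbers that
are sent within `C` are at most `E`, and any two nodes of `C` have a common neighbour in `C`. -/
structure IsCluster (bits E : ℕ) (G : SimpleGraph V) [DecidableRel G.Adj]
    (id : V ↪ ℕ) (input : V → CliqueInput) (C : Finset V) (w : V) : Prop where
  bits_le : (E + 1) ^ 2 ≤ 2 ^ bits
  id_le : ∀ v, id v ≤ E
  ac_lt : ∀ v i, (input v).acId = some i → i < E
  card_le : C.card ≤ E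
  ac : ∃ i, ∀ v, v ∈ C ↔ (input v).acId = some i
  leader_mem : w ∈ C
  leader : ∀ v ∈ C, (input v).isLeader = true ↔ v = w
  common : ∀ x ∈ C, ∀ y ∈ C, ∃ z ∈ C, G.Adj x z ∧ G.Adj y z

variable {n T : ℕ} {L : ℕ → ℕ} {bits E : ℕ} {G : SimpleGraph V} [DecidableRel G.Adj]
  {id : V ↪ ℕ} {input : V → CliqueInput} {ω : V → TrialIndex n T (L T) → Fin n.factorial}
  {C : Finset V} {w : V}

local notation "S" => nodeAt n T L bits G id input ω
local notation "mail" => mailAt n T L bits G id input ω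

theorem nodeAt_succ (t : ℕ) (v : V) : S (t + 1) v = Node.recv t (S t v) (mail t v) := rfl

theorem mailAt_eq {t : ℕ} {u v : V} (h : G.Adj v u) :
    mail t v (id u) = Node.send L t (S t u) (id v) % 2 ^ bits :=
  Code.inbox_eq _ _ _ _ _ _ h

omit [Fintype V] in
theorem pair_lt_bits (hC : IsCluster bits E G id input C w) {p q : ℕ} (hp : p ≤ E) (hq : q ≤ E) :
    Nat.pair p q < 2 ^ bits :=
  (Nat.pair_lt_max_add_one_sq p q).trans_le
    (le_trans (Nat.pow_le_pow_left (by omega) 2) hC.bits_le)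

omit [Fintype V] in
theorem lt_bits (hC : IsCluster bits E G id input C w) {p : ℕ} (hp : p ≤ E) : p < 2 ^ bits := by
  have := hC.bits_le
  nlinarith

theorem nodeAt_zero (v : V) : (S 0 v).ac = (input v).acId.elim 0 (· + 1) ∧
    (S 0 v).lead = (if (input v).isLeader then 1 else 0) ∧
    (S 0 v).nbr = (G.neighborFinset v).map id := ⟨rfl, rfl, rfl⟩

theorem mailAt_zero (hC : IsCluster bits E G id input C w) {u v : V} (h : G.Adj v u) :
    mail 0 v (id u) =
      Nat.pair ((input u).acId.elim 0 (· + 1)) (if (input u).isLeader then 1 else 0) := by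
  rw [mailAt_eq h]
  refine Nat.mod_eq_of_lt (pair_lt_bits hC (p := (input u).acId.elim 0 (· + 1))
    (q := if (input u).isLeader then 1 else 0) ?_ ?_)
  · cases hu : (input u).acId with
    | none => simp
    | some i => simpa using hC.ac_lt u i hu
  · have := card_pos.2 ⟨w, hC.leader_mem⟩
    have := hC.card_le
    split_ifs <;> omega

/-- AC-IDs are sent shifted by one, so that a node outside the family, which sends `0`, is not
mistaken for one with AC-ID `0`. -/
theorem mem_nbr_ac (hC : IsCluster bits E G id input C w) {x : V} (hx : x ∈ C) (i : ℕ) :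
    (i ∈ (S 0 x).nbr ∧ (mail 0 x i).unpair.1 = (S 0 x).ac) ↔ ∃ z ∈ C, G.Adj x z ∧ id z = i := by
  obtain ⟨k, hk⟩ := hC.ac
  rw [(nodeAt_zero x).1, (nodeAt_zero x).2.2]
  constructor
  · rintro ⟨h1, h2⟩
    obtain ⟨z, hz, rfl⟩ := mem_map.1 h1
    have hz' := (G.mem_neighborFinset x z).1 hz
    rw [mailAt_zero hC hz', Nat.unpair_pair, (hk x).1 hx] at h2
    refine ⟨z, (hk z).2 ?_, hz', rfl⟩
    cases h : (input z).acId with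
    | none => simp [h] at h2
    | some j => simpa [h] using h2
  · rintro ⟨z, hz, hxz, rfl⟩
    refine ⟨mem_map_of_mem _ ((G.mem_neighborFinset x z).2 hxz), ?_⟩
    rw [mailAt_zero hC hxz, Nat.unpair_pair, (hk x).1 hx, (hk z).1 hz]

theorem mem_cn_one (hC : IsCluster bits E G id input C w) {x : V} (hx : x ∈ C) (i : ℕ) :
    i ∈ (S 1 x).cn ↔ ∃ z ∈ C, G.Adj x z ∧ id z = i := by
  rw [← mem_nbr_ac (n := n) (T := T) (L := L) (ω := ω) hC hx i]
  exact mem_filter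

theorem leader_iff (hC : IsCluster bits E G id input C w) {x : V} (hx : x ∈ C) (i : ℕ) :
    (i ∈ (S 0 x).nbr ∧ (mail 0 x i).unpair.1 = (S 0 x).ac ∧ (mail 0 x i).unpair.2 = 1) ↔
      G.Adj x w ∧ i = id w := by
  rw [← and_assoc, mem_nbr_ac hC hx]
  constructor
  · rintro ⟨⟨z, hz, hxz, rfl⟩, h⟩
    rw [mailAt_zero hC hxz, Nat.unpair_pair] at h
    have : (input z).isLeader = true := by
      by_contra h'
      simp [h'] at h
    rw [hC.leader z hz] at this
    exact ⟨this ▸ hxz, by rw [this]⟩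
  · rintro ⟨h, rfl⟩
    refine ⟨⟨w, hC.leader_mem, h, rfl⟩, ?_⟩
    rw [mailAt_zero hC h, Nat.unpair_pair, (hC.leader w hC.leader_mem).2 rfl]
    rfl

theorem nodeAt_leader (hC : IsCluster bits E G id input C w) {x : V} (hx : x ∈ C)
    (h : G.Adj x w) : (S 1 x).leader = id w := by
  have : {i | i ∈ (S 0 x).nbr ∧ (mail 0 x i).unpair.1 = (S 0 x).ac ∧ (mail 0 x i).unpair.2 = 1}
      = {id w} := by
    ext i
    simp [leader_iff hC hx, h]
  change sInf {i | i ∈ (S 0 x).nbr ∧ (mail 0 x i).unpair.1 = (S 0 x).ac ∧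
    (mail 0 x i).unpair.2 = 1} = _
  rw [this, csInf_singleton]

theorem nodeAt_adjL (hC : IsCluster bits E G id input C w) {x : V} (hx : x ∈ C) :
    (S 1 x).adjL = if G.Adj x w then 1 else 0 := by
  change (if ∃ i ∈ (S 0 x).nbr, (mail 0 x i).unpair.1 = (S 0 x).ac ∧
    (mail 0 x i).unpair.2 = 1 then 1 else 0) = _
  simp only [leader_iff hC hx]
  simp

/-- The home of `x` relays between `x` and the leader. It exists since any two nodes of `C` have a
common neighbour in `C`; this covers neighbours of the leader and, as `x = w`, the leader itself. -/
theorem home_spec (hC : IsCluster bits E G id input C w) {x : V} (hx : x ∈ C) :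
    ∃ z ∈ C, G.Adj x z ∧ G.Adj z w ∧ id z = (S 2 x).home := by
  have hiff : ∀ i, (i ∈ (S 1 x).cn ∧ mail 1 x i = 1) ↔
      ∃ z ∈ C, G.Adj x z ∧ G.Adj z w ∧ id z = i := by
    intro i
    rw [mem_cn_one hC hx]
    have hm : ∀ z ∈ C, G.Adj x z → (mail 1 x (id z) = 1 ↔ G.Adj z w) := by
      intro z hz hxz
      rw [mailAt_eq hxz]
      change (S 1 z).adjL % 2 ^ bits = 1 ↔ _
      have := card_pos.2 ⟨w, hC.leader_mem⟩
      have h1 := lt_bits hC (p := 1) (by have := hC.card_le; omega)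
      rw [nodeAt_adjL hC hz]
      split_ifs with h
      · simp [h, Nat.mod_eq_of_lt h1]
      · simp [h]
    constructor
    · rintro ⟨⟨z, hz, hxz, rfl⟩, h⟩
      exact ⟨z, hz, hxz, (hm z hz hxz).1 h, rfl⟩
    · rintro ⟨z, hz, hxz, hzw, rfl⟩
      exact ⟨⟨z, hz, hxz, rfl⟩, (hm z hz hxz).2 hzw⟩
  obtain ⟨z, hz, h1, h2⟩ := hC.common x hx w hC.leader_mem
  have hmem := Nat.sInf_mem (s := {i | i ∈ (S 1 x).cn ∧ mail 1 x i = 1})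
    ⟨id z, (hiff _).2 ⟨z, hz, h1, h2.symm, rfl⟩⟩
  exact (hiff _).1 hmem

theorem nodeAt_kids (hC : IsCluster bits E G id input C w) {x : V} (hx : x ∈ C) :
    (S 3 x).kids = (C.filter fun z => (S 2 z).home = id x).map id := by
  have h : (S 3 x).kids = (S 1 x).cn.filter fun i => mail 2 x i = 1 := rfl
  rw [h]
  ext i
  rw [mem_filter, mem_cn_one hC hx, mem_map]
  have hm : ∀ z ∈ C, G.Adj x z → (mail 2 x (id z) = 1 ↔ (S 2 z).home = id x) := by
    intro z hz hxz
    rw [mailAt_eq hxz]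
    change (if id x = (S 2 z).home then 1 else 0) % 2 ^ bits = 1 ↔ _
    have := card_pos.2 ⟨w, hC.leader_mem⟩
    have h1 := lt_bits hC (p := 1) (by have := hC.card_le; omega)
    split_ifs with h
    · simp [h, Nat.mod_eq_of_lt h1]
    · simp [Ne.symm h]
  constructor
  · rintro ⟨⟨z, hz, hxz, rfl⟩, h⟩
    exact ⟨z, mem_filter.2 ⟨hz, (hm z hz hxz).1 h⟩, rfl⟩
  · rintro ⟨z, hz, rfl⟩
    obtain ⟨hz, h⟩ := mem_filter.1 hz
    obtain ⟨z', -, hzz', -, hid⟩ := home_spec hC hz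
    rw [h] at hid
    have hxz := (id.injective hid ▸ hzz').symm
    exact ⟨⟨z, hz, hxz, rfl⟩, (hm z hz hxz).2 h⟩

theorem nodeAt_cnt (hC : IsCluster bits E G id input C w) {x z : V} (hz : z ∈ C)
    (h : G.Adj x z) :
    (S 4 x).cnt (id z) = (C.filter fun z' => (S 2 z').home = id z).card := by
  change mail 3 x (id z) = _
  rw [mailAt_eq h]
  change (S 3 z).kids.card % 2 ^ bits = _
  rw [nodeAt_kids hC hz, card_map]
  exact Nat.mod_eq_of_lt (lt_bits hC ((card_filter_le _ _).trans hC.card_le))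

/-- The sums formed by the leader. -/
theorem sum_cnt (hC : IsCluster bits E G id input C w) (p : ℕ → Prop) [DecidablePred p] :
    ∑ j ∈ (S 4 w).cn.filter p, (S 4 w).cnt j = (C.filter fun z => p ((S 2 z).home)).card := by
  have hcn : ∀ i, i ∈ (S 4 w).cn ↔ ∃ z ∈ C, G.Adj w z ∧ id z = i :=
    mem_cn_one hC hC.leader_mem
  -- Every node of `C` is counted once, at its home, and all homes are neighbours of the leader.
  rw [card_eq_sum_card_fiberwise (f := fun z => (S 2 z).home) (t := (S 4 w).cn.filter p)]
  · refine sum_congr rfl fun j hj => ?_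
    obtain ⟨hj, hp⟩ := mem_filter.1 hj
    obtain ⟨z, hz, hwz, rfl⟩ := (hcn j).1 hj
    rw [nodeAt_cnt hC hz hwz, filter_filter]
    congr 1
    refine filter_congr fun z' _ => ?_
    constructor
    · intro h; exact ⟨h ▸ hp, h⟩
    · exact fun h => h.2
  · intro z hz
    obtain ⟨hz, hp⟩ := mem_filter.1 hz
    obtain ⟨h, hh, h1, h2, h3⟩ := home_spec (n := n) (T := T) (L := L) (ω := ω) hC hz
    exact mem_filter.2 ⟨(hcn _).2 ⟨h, hh, h2.symm, h3⟩, hp⟩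

/-- The prefix sums sent by the leader reserve disjoint consecutive intervals of labels for the
homes. -/
theorem nodeAt_base (hC : IsCluster bits E G id input C w) {x : V} (hx : x ∈ C)
    (h : G.Adj x w) :
    (S 5 x).base = (C.filter fun z => (S 2 z).home < id x).card ∧ (S 5 x).size₀ = C.card := by
  have hm : mail 4 x (id w) =
      Nat.pair (C.filter fun z => (S 2 z).home < id x).card C.card := by
    rw [mailAt_eq h]
    change Nat.pair (∑ j ∈ (S 4 w).cn.filter (· < id x), (S 4 w).cnt j)
      (∑ j ∈ (S 4 w).cn, (S 4 w).cnt j) % 2 ^ bits = _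
    have h1 := sum_cnt (n := n) (T := T) (L := L) (ω := ω) hC fun _ => True
    rw [filter_true, filter_true] at h1
    rw [sum_cnt hC, h1]
    exact Nat.mod_eq_of_lt (pair_lt_bits hC ((card_filter_le _ _).trans hC.card_le) hC.card_le)
  have hl := nodeAt_leader (n := n) (T := T) (L := L) (ω := ω) hC hx h
  change (mail 4 x (S 1 x).leader).unpair.1 = _ ∧ (mail 4 x (S 1 x).leader).unpair.2 = _
  rw [hl, hm, Nat.unpair_pair]
  exact ⟨rfl, rfl⟩

/-- A home adds to its base the position of `x` among the nodes it hosts, which yields the rank of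
`x` in the lexicographic order of (home, ID). -/
theorem nodeAt_lab (hC : IsCluster bits E G id input C w) {x : V} (hx : x ∈ C) :
    (S 6 x).lab = (C.filter fun z =>
      toLex ((S 2 z).home, id z) < toLex ((S 2 x).home, id x)).card ∧ (S 6 x).size = C.card := by
  obtain ⟨h, hh, hxh, hhw, hid⟩ := home_spec (n := n) (T := T) (L := L) (ω := ω) hC hx
  have hcard : (S 5 h).base + ((S 3 h).kids.filter (· < id x)).card = (C.filter fun z =>
      toLex ((S 2 z).home, id z) < toLex ((S 2 x).home, id x)).card := by
    rw [(nodeAt_base hC hh hhw).1, nodeAt_kids hC hh, filter_map, card_map, filter_filter,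
      ← card_union_of_disjoint]
    · congr 1
      ext z
      simp only [mem_union, mem_filter, Prod.Lex.toLex_lt_toLex, hid, Function.comp]
      tauto
    · refine disjoint_left.2 fun z hz hz' => ?_
      have := (mem_filter.1 hz).2
      have := (mem_filter.1 hz').2.1
      omega
  have hm : mail 5 x (S 2 x).home = Nat.pair (C.filter fun z =>
      toLex ((S 2 z).home, id z) < toLex ((S 2 x).home, id x)).card C.card := by
    rw [← hid, mailAt_eq hxh]
    change Nat.pair ((S 5 h).base + ((S 3 h).kids.filter (· < id x)).card) (S 5 h).size₀
      % 2 ^ bits = _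
    rw [hcard, (nodeAt_base hC hh hhw).2, hid]
    exact Nat.mod_eq_of_lt (pair_lt_bits hC ((card_filter_le _ _).trans hC.card_le) hC.card_le)
  change (mail 5 x (S 2 x).home).unpair.1 = _ ∧ (mail 5 x (S 2 x).home).unpair.2 = _
  rw [hm, Nat.unpair_pair]
  exact ⟨rfl, rfl⟩

/-- The labels number the nodes of the cluster. -/
theorem lab_bijOn (hC : IsCluster bits E G id input C w) :
    Set.InjOn (fun x => (S 7 x).lab) C ∧ C.image (fun x => (S 7 x).lab) = range C.card := by
  have h := rank_bijOn C (fun x => toLex ((S 2 x).home, id x)) (by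
    intro x _ y _ hxy
    exact id.injective (congrArg (fun p : ℕ ×ₗ ℕ => (ofLex p).2) hxy))
  have he : ∀ x ∈ C, (S 7 x).lab = (C.filter fun z =>
      toLex ((S 2 z).home, id z) < toLex ((S 2 x).home, id x)).card := fun x hx => by
    have e : (S 7 x).lab = (S 6 x).lab := rfl
    rw [e]
    exact (nodeAt_lab hC hx).1
  refine ⟨?_, ?_⟩
  · intro x hx y hy hxy
    refine h.1 hx hy ?_
    simpa only [he x hx, he y hy] using hxy
  · rw [← h.2]
    exact image_congr he

theorem nodeAt_labs (hC : IsCluster bits E G id input C w) {x z : V} (hz : z ∈ C)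
    (h : G.Adj x z) : (S 7 x).labs (id z) = (S 7 z).lab := by
  change mail 6 x (id z) = _
  rw [mailAt_eq h]
  change (S 7 z).lab % 2 ^ bits = _
  have : (S 7 z).lab < C.card := by
    rw [← mem_range, ← (lab_bijOn hC).2]
    exact mem_image_of_mem _ hz
  exact Nat.mod_eq_of_lt (lt_bits hC (this.le.trans hC.card_le))

end Execution

/-! ### Translation between nodes and labels. -/

/-- Adjacency in `G[C]`, in terms of labels. -/
def labelAdj {V : Type} (G : SimpleGraph V) (C : Finset V) (lab : V → ℕ) (c d : ℕ) : Prop :=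
  ∃ x ∈ C, ∃ z ∈ C, lab x = c ∧ lab z = d ∧ G.Adj x z

theorem labelAdj_symm {V : Type} {G : SimpleGraph V} {C : Finset V} {lab : V → ℕ} (c d : ℕ)
    (h : labelAdj G C lab c d) : labelAdj G C lab d c := by
  obtain ⟨x, hx, z, hz, h1, h2, h3⟩ := h
  exact ⟨z, hz, x, hx, h2, h1, h3.symm⟩

theorem labelAdj_left_iff {V : Type} {G : SimpleGraph V} {C : Finset V} {lab : V → ℕ}
    (hinj : Set.InjOn lab C) {x : V} (hx : x ∈ C) {d : ℕ} :
    labelAdj G C lab (lab x) d ↔ ∃ z ∈ C, G.Adj x z ∧ lab z = d := by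
  constructor
  · rintro ⟨x', hx', z, hz, h1, h2, h3⟩
    rw [hinj hx' hx h1] at h3
    exact ⟨z, hz, h3, h2⟩
  · rintro ⟨z, hz, h1, h2⟩
    exact ⟨x, hx, z, hz, rfl, h2, h1⟩

theorem labelAdj_iff {V : Type} {G : SimpleGraph V} {C : Finset V} {lab : V → ℕ}
    (hinj : Set.InjOn lab C) {x z : V} (hx : x ∈ C) (hz : z ∈ C) :
    labelAdj G C lab (lab x) (lab z) ↔ G.Adj x z := by
  rw [labelAdj_left_iff hinj hx]
  constructor
  · rintro ⟨z', hz', h, he⟩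
    rwa [← hinj hz' hz he]
  · exact fun h => ⟨z, hz, h, rfl⟩

/-- Messages carry a label plus one, leaving `0` for silence. -/
theorem code_eq_succ_iff {P : ℕ → Prop} (hP : ∀ v v', P v → P v' → v = v') (v : ℕ) :
    (if ∃ v, P v then sInf {v | P v} + 1 else 0) = v + 1 ↔ P v := by
  split_ifs with h
  · have hm := Nat.sInf_mem (s := {v | P v}) h
    constructor
    · intro he
      rw [← Nat.succ_injective he]
      exact hm
    · intro hv
      rw [hP _ _ hm hv]
  · simp only [false_iff]
    exact fun hv => h ⟨v, hv⟩

theorem requests_unique {N u : ℕ} {nb : ℕ → Prop} {out : ℕ → Option ℕ} {L : ℕ} {y : ℕ → ℕ → ℕ}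
    {w v v' : ℕ} (h : Requests N u nb out L y w v) (h' : Requests N u nb out L y w v') :
    v = v' := by
  rcases lt_trichotomy v v' with hv | hv | hv
  · exact absurd h.1 (h'.2 _ hv)
  · exact hv
  · exact absurd h'.1 (h.2 _ hv)

/-! ### The message-passing phases simulate the colouring process. -/

section Execution

variable {V : Type} [Fintype V] {n T : ℕ} {L : ℕ → ℕ} {bits E : ℕ} {G : SimpleGraph V}
  [DecidableRel G.Adj] {id : V ↪ ℕ} {input : V → CliqueInput}
  {ω : V → TrialIndex n T (L T) → Fin n.factorial}
  {C : Finset V} {w : V} {lab : V → ℕ} {Y : ℕ → ℕ → ℕ → ℕ → ℕ}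

local notation "S" => nodeAt n T L bits G id input ω
local notation "mail" => mailAt n T L bits G id input ω
local notation "R" => labelAdj G C lab
local notation "P" => pstate (card C) (labelAdj G C lab) L Y

/-- The first seven rounds do not use the random numbers. -/
theorem nodeAt_setup (ω' : V → TrialIndex n T (L T) → Fin n.factorial) (t : ℕ) (ht : t ≤ 7)
    (v : V) : S t v = { nodeAt n T L bits G id input ω' t v with
      seed := fun t v' l => ω v (trialIndex n T (L T) t v' l) } := by
  induction t generalizing v with
  | zero => rfl
  | succ t ih =>
    have ih := ih (by omega)
    have hsend : ∀ u i, Node.send L t (S t u) i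
        = Node.send L t (nodeAt n T L bits G id input ω' t u) i := by
      intro u i
      rw [ih u]
      obtain rfl | rfl | rfl | rfl | rfl | rfl | rfl :
        t = 0 ∨ t = 1 ∨ t = 2 ∨ t = 3 ∨ t = 4 ∨ t = 5 ∨ t = 6 := by omega
      all_goals rfl
    have hmail : mail t v = mailAt n T L bits G id input ω' t v := by
      funext i
      unfold mailAt Code.inbox
      split_ifs with h
      · exact congrArg (· % 2 ^ bits) (hsend _ _)
      · rfl
    rw [nodeAt_succ, nodeAt_succ, hmail, ih v]
    obtain rfl | rfl | rfl | rfl | rfl | rfl | rfl :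
      t = 0 ∨ t = 1 ∨ t = 2 ∨ t = 3 ∨ t = 4 ∨ t = 5 ∨ t = 6 := by omega
    all_goals rfl

/-- This allows the labels to be fixed before the seeds are drawn, so that trials indexed by labels
correspond to fixed coordinates of the seed space. -/
theorem nodeAt_lab_indep (ω' : V → TrialIndex n T (L T) → Fin n.factorial) (v : V) :
    (S 7 v).lab = (nodeAt n T L bits G id input ω' 7 v).lab := by
  rw [nodeAt_setup ω' 7 le_rfl v]

theorem nodeAt_seed (v : V) :
    (S 7 v).seed = fun t v' l => (ω v (trialIndex n T (L T) t v' l) : ℕ) := by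
  rw [nodeAt_setup ω 7 le_rfl v]

theorem nodeAt_seven (v : V) : (S 7 v).out = (fun _ => none) ∧ (S 7 v).busy = (fun _ => False) ∧
    (S 7 v).known = fun _ _ => False := ⟨rfl, rfl, rfl⟩

theorem nodeAt_static (t : ℕ) (v : V) :
    (S (t + 7) v).cn = (S 7 v).cn ∧ (S (t + 7) v).labs = (S 7 v).labs ∧
    (S (t + 7) v).size = (S 7 v).size ∧ (S (t + 7) v).lab = (S 7 v).lab ∧
    (S (t + 7) v).seed = (S 7 v).seed := by
  induction t with
  | zero => rw [Nat.zero_add]; exact ⟨rfl, rfl, rfl, rfl, rfl⟩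
  | succ t ih =>
    have e : S (t + 1 + 7) v = if t % 2 = 0 then (S (t + 7) v).recvRequests (mail (t + 7) v)
        else (S (t + 7) v).recvAnswers (mail (t + 7) v) := rfl
    rw [e]
    split_ifs <;> exact ih

theorem nodeAt_even (p : ℕ) (v : V) :
    S (2 * p + 1 + 7) v = (S (2 * p + 7) v).recvRequests (mail (2 * p + 7) v) := by
  have e : S (2 * p + 1 + 7) v =
      if 2 * p % 2 = 0 then (S (2 * p + 7) v).recvRequests (mail (2 * p + 7) v)
        else (S (2 * p + 7) v).recvAnswers (mail (2 * p + 7) v) := rfl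
  rw [e, if_pos (by omega)]

theorem nodeAt_odd (p : ℕ) (v : V) :
    S (2 * (p + 1) + 7) v = (S (2 * p + 1 + 7) v).recvAnswers (mail (2 * p + 1 + 7) v) := by
  have e : S (2 * (p + 1) + 7) v =
      if (2 * p + 1) % 2 = 0 then (S (2 * p + 1 + 7) v).recvRequests (mail (2 * p + 1 + 7) v)
        else (S (2 * p + 1 + 7) v).recvAnswers (mail (2 * p + 1 + 7) v) := rfl
  rw [e, if_neg (by omega)]

theorem send_even (p : ℕ) (s : Node) (i : ℕ) :
    Node.send L (2 * p + 7) s i = s.request L p i := by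
  have e : Node.send L (2 * p + 7) s i =
      if 2 * p % 2 = 0 then s.request L (2 * p / 2) i else s.pend i := rfl
  rw [e, if_pos (by omega), Nat.mul_div_cancel_left _ two_pos]

theorem send_odd (p : ℕ) (s : Node) (i : ℕ) :
    Node.send L (2 * p + 1 + 7) s i = s.pend i := by
  have e : Node.send L (2 * p + 1 + 7) s i =
      if (2 * p + 1) % 2 = 0 then s.request L ((2 * p + 1) / 2) i else s.pend i := rfl
  rw [e, if_neg (by omega)]

/-- `lab` is the labelling computed by the cluster `C`, and `Y` are the random trials. -/
structure IsLabelled (n T : ℕ) (L : ℕ → ℕ) (bits E : ℕ) (G : SimpleGraph V) [DecidableRel G.Adj]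
    (id : V ↪ ℕ) (input : V → CliqueInput) (ω : V → TrialIndex n T (L T) → Fin n.factorial)
    (C : Finset V) (w : V) (lab : V → ℕ) (Y : ℕ → ℕ → ℕ → ℕ → ℕ) : Prop where
  cluster : IsCluster bits E G id input C w
  lab_eq : ∀ x, (nodeAt n T L bits G id input ω 7 x).lab = lab x
  trial_eq : ∀ x ∈ C, ∀ t v l, (ω x (trialIndex n T (L T) t v l) : ℕ) % card C = Y t (lab x) v l

section

variable (h : IsLabelled n T L bits E G id input ω C w lab Y)

include h

theorem IsLabelled.injOn : Set.InjOn lab C := by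
  have := (lab_bijOn (n := n) (T := T) (L := L) (ω := ω) h.cluster).1
  rwa [funext h.lab_eq] at this

theorem IsLabelled.image : C.image lab = range (card C) := by
  have := (lab_bijOn (n := n) (T := T) (L := L) (ω := ω) h.cluster).2
  rwa [funext h.lab_eq] at this

theorem IsLabelled.lt {x : V} (hx : x ∈ C) : lab x < card C := by
  rw [← mem_range, ← h.image]
  exact mem_image_of_mem _ hx

theorem IsLabelled.mem_cn {x : V} (hx : x ∈ C) (t i : ℕ) :
    i ∈ (S (t + 7) x).cn ↔ ∃ z ∈ C, G.Adj x z ∧ id z = i := by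
  rw [(nodeAt_static t x).1]
  exact mem_cn_one h.cluster hx i

theorem IsLabelled.labs_eq {x z : V} (hz : z ∈ C) (hxz : G.Adj x z) (t : ℕ) :
    (S (t + 7) x).labs (id z) = lab z := by
  rw [(nodeAt_static t x).2.1, nodeAt_labs h.cluster hz hxz, h.lab_eq]

/-- Quantification over the neighbours in the cluster. -/
theorem IsLabelled.exists_cn {x : V} (hx : x ∈ C) (t : ℕ) (Q : ℕ → ℕ → Prop) :
    (∃ i ∈ (S (t + 7) x).cn, Q i ((S (t + 7) x).labs i)) ↔
      ∃ z ∈ C, G.Adj x z ∧ Q (id z) (lab z) := by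
  constructor
  · rintro ⟨i, hi, hQ⟩
    obtain ⟨z, hz, hxz, rfl⟩ := (h.mem_cn hx t i).1 hi
    exact ⟨z, hz, hxz, h.labs_eq hz hxz t ▸ hQ⟩
  · rintro ⟨z, hz, hxz, hQ⟩
    exact ⟨id z, (h.mem_cn hx t _).2 ⟨z, hz, hxz, rfl⟩, (h.labs_eq hz hxz t).symm ▸ hQ⟩

theorem IsLabelled.nb_eq {x : V} (hx : x ∈ C) (t : ℕ) : (S (t + 7) x).nb = R (lab x) := by
  funext c
  rw [labelAdj_left_iff h.injOn hx]
  exact propext (h.exists_cn hx t fun _ b => b = c)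

theorem IsLabelled.size_eq {x : V} (hx : x ∈ C) (t : ℕ) : (S (t + 7) x).size = card C := by
  have e : (S 7 x).size = (S 6 x).size := rfl
  rw [(nodeAt_static t x).2.2.1, e]
  exact (nodeAt_lab h.cluster hx).2

theorem IsLabelled.seed_eq {x : V} (hx : x ∈ C) (t : ℕ) (p : ℕ) :
    (fun v l => (S (t + 7) x).seed p v l % (S (t + 7) x).size) = Y p (lab x) := by
  funext v l
  rw [h.size_eq hx, (nodeAt_static t x).2.2.2.2, nodeAt_seed]
  exact h.trial_eq x hx p v l

/-- The memory of the nodes of `C` after `p` phases agrees with the process on labels. -/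
def Simulates (n T : ℕ) (L : ℕ → ℕ) (bits : ℕ) (G : SimpleGraph V) [DecidableRel G.Adj]
    (id : V ↪ ℕ) (input : V → CliqueInput) (ω : V → TrialIndex n T (L T) → Fin n.factorial)
    (C : Finset V) (lab : V → ℕ) (Y : ℕ → ℕ → ℕ → ℕ → ℕ) (p : ℕ) : Prop :=
  let s := nodeAt n T L bits G id input ω (2 * p + 7)
  let q := pstate (card C) (labelAdj G C lab) L Y p
  ∀ x ∈ C, (s x).out = q.out (lab x) ∧ (s x).busy = q.busy (lab x) ∧
    (∀ c i, (s x).known c i → ∃ z ∈ C, lab z = c ∧ id z = i) ∧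
    ∀ c, q.out (lab x) c ≠ none → ∃ i, (s x).known c i

variable {p : ℕ} (hp : Simulates n T L bits G id input ω C lab Y p)

include hp

theorem IsLabelled.request_iff {x z : V} (hx : x ∈ C) (hz : z ∈ C) (hzx : G.Adj z x) (v : ℕ) :
    mail (2 * p + 7) z (id x) = v + 1 ↔
      Requests (card C) (lab x) (R (lab x)) ((P p).out (lab x)) (L p) (Y p (lab x)) (lab z) v := by
  have e : Node.send L (2 * p + 7) (S (2 * p + 7) x) (id z) =
      if ∃ v, Requests (card C) (lab x) (R (lab x)) ((P p).out (lab x)) (L p) (Y p (lab x)) (lab z) v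
      then sInf {v | Requests (card C) (lab x) (R (lab x)) ((P p).out (lab x)) (L p) (Y p (lab x))
        (lab z) v} + 1 else 0 := by
    rw [send_even, Node.request, h.seed_eq hx, h.nb_eq hx, h.size_eq hx, h.labs_eq hz hzx.symm,
      (hp x hx).1, (nodeAt_static _ x).2.2.2.1, h.lab_eq]
  have hlt : Node.send L (2 * p + 7) (S (2 * p + 7) x) (id z) < 2 ^ bits := by
    refine lt_bits h.cluster ?_
    rw [e]
    split_ifs with hex
    · have hm := Nat.sInf_mem (s := {v | Requests (card C) (lab x) (R (lab x)) ((P p).out (lab x))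
        (L p) (Y p (lab x)) (lab z) v}) hex
      exact le_trans (Nat.succ_le_of_lt hm.1.2.1) h.cluster.card_le
    · exact Nat.zero_le _
  rw [mailAt_eq hzx, Nat.mod_eq_of_lt hlt, e]
  exact code_eq_succ_iff (fun _ _ => requests_unique) v

theorem IsLabelled.mate_eq {x : V} (hx : x ∈ C) :
    (S (2 * p + 7) x).mate (mail (2 * p + 7) x) = mateAt (card C) R (L p) (P p) (Y p) (lab x) := by
  have hreq : (S (2 * p + 7) x).req (mail (2 * p + 7) x)
      = reqAt (card C) R (L p) (P p) (Y p) (lab x) := by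
    funext u v
    refine propext ((h.exists_cn hx (2 * p)
      fun i b => b = u ∧ mail (2 * p + 7) x i = v + 1).trans ?_)
    unfold reqAt
    rw [labelAdj_left_iff h.injOn hx]
    constructor
    · rintro ⟨z, hz, hxz, rfl, hr⟩
      exact ⟨⟨z, hz, hxz, rfl⟩, (h.request_iff hp hz hx hxz v).1 hr⟩
    · rintro ⟨⟨z, hz, hxz, rfl⟩, hr⟩
      exact ⟨z, hz, hxz, rfl, (h.request_iff hp hz hx hxz v).2 hr⟩
  rw [Node.mate, hreq, h.nb_eq hx, (hp x hx).2.1]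
  rfl

/-- Acceptances at `x` form a matching, so one answer per neighbour suffices. It carries the
partner's ID with its label, since nodes know the IDs of their neighbours but not of their
non-neighbours. -/
theorem IsLabelled.answer_spec {x z : V} (hx : x ∈ C) (hz : z ∈ C) (hzx : G.Adj z x) :
    (mail (2 * p + 1 + 7) z (id x) = 0 ∧
      ∀ c, ¬ mateAt (card C) R (L p) (P p) (Y p) (lab x) (lab z) c) ∨
    ∃ v ∈ C, mateAt (card C) R (L p) (P p) (Y p) (lab x) (lab z) (lab v) ∧
      mail (2 * p + 1 + 7) z (id x) = Nat.pair (lab v + 1) (id v) := by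
  have hpend : (S (2 * p + 1 + 7) x).pend (id z) =
      if hex : ∃ j ∈ (S (2 * p + 7) x).cn, (S (2 * p + 7) x).mate (mail (2 * p + 7) x)
        ((S (2 * p + 7) x).labs (id z)) ((S (2 * p + 7) x).labs j)
      then Nat.pair ((S (2 * p + 7) x).labs hex.choose + 1) hex.choose else 0 := by
    rw [nodeAt_even]
    rfl
  have hgood : (P p).Good (card C) R := pstate_good (fun _ _ => labelAdj_symm _ _) p
  rw [mailAt_eq hzx, send_odd, hpend]
  split_ifs with hex
  · right
    obtain ⟨hj, hm⟩ := hex.choose_spec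
    obtain ⟨v, hv, hxv, hid⟩ := (h.mem_cn hx _ _).1 hj
    rw [← hid] at hm ⊢
    rw [h.mate_eq hp hx, h.labs_eq hz hzx.symm, h.labs_eq hv hxv] at hm
    refine ⟨v, hv, hm, ?_⟩
    rw [h.labs_eq hv hxv]
    exact Nat.mod_eq_of_lt (pair_lt_bits h.cluster
      (le_trans (Nat.succ_le_of_lt (h.lt hv)) h.cluster.card_le) (h.cluster.id_le v))
  · left
    refine ⟨Nat.zero_mod _, fun c hc => hex ?_⟩
    obtain ⟨v, hv, hxv, rfl⟩ := (labelAdj_left_iff h.injOn hx).1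
      (mateAt_prop (fun _ _ => labelAdj_symm _ _) hgood hc).2.1
    refine ⟨id v, (h.mem_cn hx _ _).2 ⟨v, hv, hxv, rfl⟩, ?_⟩
    rw [h.mate_eq hp hx, h.labs_eq hz hzx.symm, h.labs_eq hv hxv]
    exact hc

theorem IsLabelled.simulates_succ : Simulates n T L bits G id input ω C lab Y (p + 1) := by
  intro z hz
  have hgood : (P p).Good (card C) R := pstate_good (fun _ _ => labelAdj_symm _ _) p
  have hbusy : (S (2 * p + 1 + 7) z).busy = (P (p + 1)).busy (lab z) := by
    rw [nodeAt_even]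
    funext c
    change ((S (2 * p + 7) z).busy c ∨ ∃ v, (S (2 * p + 7) z).mate (mail (2 * p + 7) z) c v) = _
    rw [h.mate_eq hp hz, (hp z hz).2.1]
    rfl
  have hout : (S (2 * p + 1 + 7) z).out = (P p).out (lab z) := by
    rw [nodeAt_even]
    exact (hp z hz).1
  have hknown : (S (2 * p + 1 + 7) z).known = (S (2 * p + 7) z).known := by
    rw [nodeAt_even]
    rfl
  -- The answers received by `z` are exactly the acceptances involving `z`; both ends of an accepted
  -- pair are told, so both update alike.
  have hmid : (fun y c => ∃ i ∈ (S (2 * p + 1 + 7) z).cn, (S (2 * p + 1 + 7) z).labs i = c ∧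
      (mail (2 * p + 1 + 7) z i).unpair.1 = y + 1)
      = fun y c => mateAt (card C) R (L p) (P p) (Y p) c (lab z) y := by
    funext y c
    refine propext ((h.exists_cn hz (2 * p + 1)
      fun i b => b = c ∧ (mail (2 * p + 1 + 7) z i).unpair.1 = y + 1).trans ?_)
    constructor
    · rintro ⟨x, hx, hzx, rfl, hm⟩
      rcases h.answer_spec hp hx hz hzx with ⟨h0, -⟩ | ⟨v, hv, hmate, hm'⟩
      · rw [h0] at hm
        simp at hm
      · rw [hm', Nat.unpair_pair] at hm
        rwa [← Nat.succ_injective hm]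
    · intro hmate
      obtain ⟨x, hx, hzx, rfl⟩ := (labelAdj_left_iff h.injOn hz).1
        (labelAdj_symm _ _ (mateAt_prop (fun _ _ => labelAdj_symm _ _) hgood hmate).1)
      refine ⟨x, hx, hzx, rfl, ?_⟩
      rcases h.answer_spec hp hx hz hzx with ⟨-, h0⟩ | ⟨v, hv, hmate', hm'⟩
      · exact absurd hmate (h0 _)
      · rw [hm', Nat.unpair_pair, mateAt_unique hmate hmate']
  have hout' : (S (2 * (p + 1) + 7) z).out = (P (p + 1)).out (lab z) := by
    rw [nodeAt_odd]
    change newOut (S (2 * p + 1 + 7) z).out _ = _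
    rw [hmid, hout]
    rfl
  refine ⟨hout', ?_, ?_, ?_⟩
  · rw [nodeAt_odd]
    exact hbusy
  · intro c i hc
    rw [nodeAt_odd] at hc
    rcases hc with hc | ⟨j, hj, hm⟩
    · rw [hknown] at hc
      exact (hp z hz).2.2.1 c i hc
    · obtain ⟨x, hx, hzx, rfl⟩ := (h.mem_cn hz _ _).1 hj
      rcases h.answer_spec hp hx hz hzx with ⟨h0, -⟩ | ⟨v, hv, -, hm'⟩
      · rw [h0] at hm
        have := congrArg (fun m => (Nat.unpair m).1) hm
        simp at this
      · rw [hm', Nat.pair_eq_pair] at hm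
        exact ⟨v, hv, Nat.succ_injective hm.1, hm.2⟩
  · intro c hc
    rw [nodeAt_odd]
    by_cases hold : (P p).out (lab z) c = none
    · have : ∃ b, mateAt (card C) R (L p) (P p) (Y p) b (lab z) c := by
        by_contra hno
        push Not at hno
        exact hc (PState.step_out_eq_none_iff.2 ⟨hold, hno⟩)
      obtain ⟨b, hb⟩ := this
      have : ∃ i ∈ (S (2 * p + 1 + 7) z).cn, (S (2 * p + 1 + 7) z).labs i = b ∧
          (mail (2 * p + 1 + 7) z i).unpair.1 = c + 1 := by
        rw [show (∃ i ∈ (S (2 * p + 1 + 7) z).cn, (S (2 * p + 1 + 7) z).labs i = b ∧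
          (mail (2 * p + 1 + 7) z i).unpair.1 = c + 1) = _ from congrFun (congrFun hmid c) b]
        exact hb
      obtain ⟨i, hi, -, hm⟩ := this
      refine ⟨(mail (2 * p + 1 + 7) z i).unpair.2, Or.inr ⟨i, hi, ?_⟩⟩
      rw [← hm, Nat.pair_unpair]
    · obtain ⟨i, hi⟩ := (hp z hz).2.2.2 c hold
      exact ⟨i, Or.inl (hknown ▸ hi)⟩

end

theorem IsLabelled.simulates (h : IsLabelled n T L bits E G id input ω C w lab Y) (p : ℕ) :
    Simulates n T L bits G id input ω C lab Y p := by
  induction p with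
  | zero =>
    intro x _
    have := nodeAt_seven (n := n) (T := T) (L := L) (bits := bits) (G := G) (id := id)
      (input := input) (ω := ω) x
    exact ⟨this.1, this.2.1, fun c i hc => hc.elim, fun c hc => (hc rfl).elim⟩
  | succ p ih => exact h.simulates_succ ih

end Execution

/-! ### From a complete colouring to an overlay known to the nodes. -/

section Outcome

variable {V : Type} [Fintype V] {n T : ℕ} {L : ℕ → ℕ} {bits E : ℕ} {G : SimpleGraph V}
  [DecidableRel G.Adj] {id : V ↪ ℕ} {input : V → CliqueInput}
  {ω : V → TrialIndex n T (L T) → Fin n.factorial}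
  {C : Finset V} {w : V} {lab : V → ℕ} {Y : ℕ → ℕ → ℕ → ℕ → ℕ}

local notation "S" => nodeAt n T L bits G id input ω
local notation "R" => labelAdj G C lab
local notation "P" => pstate (card C) (labelAdj G C lab) L Y

omit [Fintype V] [DecidableRel G.Adj] in
theorem pstate_labelAdj_good (p : ℕ) : (P p).Good (card C) R :=
  pstate_good (fun _ _ => labelAdj_symm _ _) p

/-- The arbitrary choice in `Node.output` is harmless: `known` only links a label to the ID of its
own node, and labels are injective on `C`, so the witness must be `m`. -/
theorem IsLabelled.output_eq (h : IsLabelled n T L bits E G id input ω C w lab Y) {p : ℕ}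
    {u v m : V} (hu : u ∈ C) (hv : v ∈ C) (hm : m ∈ C)
    (hout : (P p).out (lab u) (lab v) = some (lab m)) :
    (S (2 * p + 7) u).output (id v) = some (id m) := by
  obtain ⟨h1, -, h3, h4⟩ := h.simulates p u hu
  have hadj : G.Adj u m := by
    have := ((pstate_labelAdj_good p).path _ _ _ hout).1
    exact ((labelAdj_iff h.injOn hm hu).1 this).symm
  have hknown : (S (2 * p + 7) u).known (lab v) (id v) := by
    obtain ⟨i, hi⟩ := h4 (lab v) (by rw [hout]; simp)
    obtain ⟨z, hz, hzv, rfl⟩ := h3 _ _ hi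
    rwa [h.injOn hz hv hzv] at hi
  have hex : ∃ j ∈ (S (2 * p + 7) u).cn, ∃ y, (S (2 * p + 7) u).known y (id v) ∧
      (S (2 * p + 7) u).out y = some ((S (2 * p + 7) u).labs j) := by
    refine ⟨id m, (h.mem_cn hu _ _).2 ⟨m, hm, hadj, rfl⟩, lab v, hknown, ?_⟩
    rw [h1, h.labs_eq hm hadj, hout]
  rw [Node.output, dif_pos hex]
  obtain ⟨hj, y, hy, ho⟩ := hex.choose_spec
  generalize hex.choose = j at hj ho ⊢
  obtain ⟨m', hm', hadj', hid⟩ := (h.mem_cn hu _ _).1 hj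
  obtain ⟨z, hz, rfl, hzv⟩ := h3 _ _ hy
  rw [h1, id.injective hzv, hout, ← hid, h.labs_eq hm' hadj'] at ho
  rw [← hid, h.injOn hm' hm (Option.some_injective _ ho).symm]

theorem IsLabelled.output_eq_none (h : IsLabelled n T L bits E G id input ω C w lab Y) {p : ℕ}
    {u : V} (hu : u ∈ C) {i : ℕ} (hi : ∀ v, IsNonEdge G C u v → id v ≠ i) :
    (S (2 * p + 7) u).output i = none := by
  obtain ⟨h1, -, h3, -⟩ := h.simulates p u hu
  rw [Node.output, dif_neg]
  rintro ⟨j, -, y, hy, ho⟩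
  obtain ⟨z, hz, rfl, rfl⟩ := h3 _ _ hy
  rw [h1] at ho
  have hp := (pstate_labelAdj_good p).path _ _ _ ho
  exact hi z ⟨hu, hz, fun e => hp.2.2.2.1 (e ▸ rfl),
    fun hadj => hp.2.2.1 ((labelAdj_iff h.injOn hu hz).2 hadj)⟩ rfl

/-- The paths chosen after `p` phases. -/
noncomputable def pathsOf (C : Finset V) (lab : V → ℕ) (out : ℕ → ℕ → Option ℕ) :
    Finset (Sym2 V × V) :=
  univ.filter fun q => q.2 ∈ C ∧ ∃ u ∈ C, ∃ v ∈ C, q.1 = s(u, v) ∧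
    out (lab u) (lab v) = some (lab q.2)

theorem mem_pathsOf {out : ℕ → ℕ → Option ℕ} {e : Sym2 V} {m : V} :
    (e, m) ∈ pathsOf C lab out ↔ m ∈ C ∧ ∃ u ∈ C, ∃ v ∈ C, e = s(u, v) ∧
      out (lab u) (lab v) = some (lab m) := by
  simp [pathsOf]

-- For a fixed end `a` and middle `b`, `PState.Good.inj` leaves one possible path. The edge can be
-- traversed with either of its endpoints in the role of the middle, hence `2`.
omit [DecidableRel G.Adj] in
theorem edgeOccurrences_pathsOf_le [DecidableEq V] (hlab : Set.InjOn lab C) {s : PState} {N : ℕ}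
    (hs : s.Good N R) (a b : V) : edgeOccurrences (pathsOf C lab s.out) s(a, b) ≤ 2 := by
  have hnorm : ∀ a b e, (e, b) ∈ pathsOf C lab s.out → a ∈ e →
      ∃ v ∈ C, e = s(a, v) ∧ s.out (lab a) (lab v) = some (lab b) := by
    intro a b e hq ha
    obtain ⟨-, u, hu, v, hv, rfl, ho⟩ := mem_pathsOf.1 hq
    rcases Sym2.mem_iff.1 ha with rfl | rfl
    · exact ⟨v, hv, rfl, ho⟩
    · exact ⟨u, hu, Sym2.eq_swap, hs.symm _ _ ▸ ho⟩
  have hF : ∀ a b, ((pathsOf C lab s.out).filter fun q => a ∈ q.1 ∧ q.2 = b).card ≤ 1 := by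
    intro a b
    refine card_le_one.2 ?_
    rintro ⟨e, m⟩ hq ⟨e', m'⟩ hq'
    obtain ⟨hp, ha, hm⟩ := mem_filter.1 hq
    obtain ⟨hp', ha', hm'⟩ := mem_filter.1 hq'
    dsimp only at ha ha' hm hm'
    subst hm
    subst hm'
    obtain ⟨v, hv, rfl, ho⟩ := hnorm a _ _ hp ha
    obtain ⟨v', hv', rfl, ho'⟩ := hnorm a _ _ hp' ha'
    rw [hlab hv hv' (hs.inj _ _ _ _ ho ho')]
  have hsub : ((pathsOf C lab s.out).filter fun q => ∃ x : V, x ∈ q.1 ∧ s(a, b) = s(x, q.2)) ⊆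
      ((pathsOf C lab s.out).filter fun q => a ∈ q.1 ∧ q.2 = b) ∪
        (pathsOf C lab s.out).filter fun q => b ∈ q.1 ∧ q.2 = a := by
    intro q hq
    obtain ⟨hq, x, hx, he⟩ := mem_filter.1 hq
    rcases Sym2.eq_iff.1 he with ⟨ha, hb⟩ | ⟨ha, hb⟩
    · exact mem_union_left _ (mem_filter.2 ⟨hq, ha ▸ hx, hb.symm⟩)
    · exact mem_union_right _ (mem_filter.2 ⟨hq, hb ▸ hx, ha.symm⟩)
  have h1 := (card_le_card hsub).trans (card_union_le _ _)
  have h2 : edgeOccurrences (pathsOf C lab s.out) s(a, b) =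
      ((pathsOf C lab s.out).filter fun q => ∃ x : V, x ∈ q.1 ∧ s(a, b) = s(x, q.2)).card := by
    unfold edgeOccurrences
    congr!
  have := hF a b
  have := hF b a
  omega

/-- If the process colours all non-edges, the nodes output an overlay of congestion `2`. -/
theorem IsLabelled.exists_overlay [DecidableEq V]
    (h : IsLabelled n T L bits E G id input ω C w lab Y) {p : ℕ}
    (hdone : ∀ u v, u < v → v < card C → ¬ R u v → (P p).out u v ≠ none) :
    ∃ O : Finset (Sym2 V × V), IsCliqueOverlay G C O ∧ overlayCongestion G O ≤ 2 ∧
      KnowsOverlay G id C O fun u => (S (2 * p + 7) u).output := by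
  have hgood := pstate_labelAdj_good (G := G) (C := C) (lab := lab) (L := L) (Y := Y) p
  have hmid : ∀ u v, IsNonEdge G C u v → ∃ m ∈ C, (P p).out (lab u) (lab v) = some (lab m) := by
    rintro u v ⟨hu, hv, hne, hadj⟩
    have hnR : ¬ R (lab u) (lab v) := fun hr => hadj ((labelAdj_iff h.injOn hu hv).1 hr)
    have hsome : (P p).out (lab u) (lab v) ≠ none := by
      rcases lt_trichotomy (lab u) (lab v) with hlt | heq | hlt
      · exact hdone _ _ hlt (h.lt hv) hnR
      · exact absurd (h.injOn hu hv heq) hne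
      · rw [hgood.symm]
        exact hdone _ _ hlt (h.lt hu) fun hr => hnR (labelAdj_symm _ _ hr)
    obtain ⟨c, hc⟩ := Option.ne_none_iff_exists'.1 hsome
    obtain ⟨m, hm, -, -, rfl, -⟩ := (hgood.path _ _ _ hc).1
    exact ⟨m, hm, hc⟩
  have hO : ∀ u v m, u ∈ C → v ∈ C → m ∈ C → (P p).out (lab u) (lab v) = some (lab m) →
      (s(u, v), m) ∈ pathsOf C lab (P p).out := fun u v m hu hv hm ho =>
    mem_pathsOf.2 ⟨hm, u, hu, v, hv, rfl, ho⟩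
  refine ⟨pathsOf C lab (P p).out, ⟨?_, ?_⟩, ?_, ?_, ?_⟩
  · rintro ⟨e, m⟩ hq
    obtain ⟨hm, u, hu, v, hv, rfl, ho⟩ := mem_pathsOf.1 hq
    obtain ⟨h1, h2, -, h4, -⟩ := hgood.path _ _ _ ho
    refine ⟨fun hd => h4 (congrArg lab (Sym2.mk_isDiag_iff.1 hd)), hm, fun x hx => ?_⟩
    rcases Sym2.mem_iff.1 hx with rfl | rfl
    · exact ⟨hu, ((labelAdj_iff h.injOn hm hu).1 h1).symm⟩
    · exact ⟨hv, ((labelAdj_iff h.injOn hm hv).1 h2).symm⟩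
  · intro u v huv
    obtain ⟨m, hm, ho⟩ := hmid u v huv
    exact ⟨m, hO u v m huv.1 huv.2.1 hm ho⟩
  · refine Finset.sup_le fun e _ => ?_
    induction e with
    | _ a b => exact edgeOccurrences_pathsOf_le h.injOn hgood a b
  · intro u v huv
    obtain ⟨m, hm, ho⟩ := hmid u v huv
    exact ⟨m, hO u v m huv.1 huv.2.1 hm ho, h.output_eq huv.1 huv.2.1 hm ho,
      h.output_eq huv.2.1 huv.1 hm (hgood.symm _ _ ▸ ho)⟩
  · intro u hu i hi
    exact h.output_eq_none hu hi

end Outcome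

/-! ### The probability of failure -/

/-- Within these ranges `Fin.ofNat` does not wrap around, so different trials of a node use
different random numbers. -/
theorem trialIndex_inj {n T Lmax t t' v v' l l' : ℕ} (ht : t ≤ T) (ht' : t' ≤ T) (hv : v ≤ n)
    (hv' : v' ≤ n) (hl : l ≤ Lmax) (hl' : l' ≤ Lmax)
    (h : trialIndex n T Lmax t v l = trialIndex n T Lmax t' v' l') : t = t' ∧ v = v' ∧ l = l' := by
  simp only [trialIndex, Prod.mk.injEq, Fin.ext_iff, Fin.val_ofNat] at h
  rw [Nat.mod_eq_of_lt (by omega), Nat.mod_eq_of_lt (by omega), Nat.mod_eq_of_lt (by omega),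
    Nat.mod_eq_of_lt (by omega), Nat.mod_eq_of_lt (by omega), Nat.mod_eq_of_lt (by omega)] at h
  exact h

/-- The nodes of a cluster in which every node has few non-neighbours compute an overlay, except
for a small set of seeds. -/
theorem exists_fail_set {V : Type} [Fintype V] [DecidableEq V] {n T : ℕ} {L : ℕ → ℕ} {bits E : ℕ}
    {G : SimpleGraph V} [DecidableRel G.Adj] {id : V ↪ ℕ} {input : V → CliqueInput}
    {C : Finset V} {w : V} (hC : IsCluster bits E G id input C w) (hn : C.card ≤ n)
    (hL : ∀ t < T, L t = 1) (hLT : 1 ≤ L T) {D r : ℕ} (hD : 8 * D ≤ C.card)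
    (hdeg : ∀ x ∈ C, (C.filter fun z => ¬ G.Adj x z).card ≤ D)
    (hr : ∀ m < r, 8 * (L T * m) ≤ C.card) :
    ∃ F : Finset (V → TrialIndex n T (L T) → Fin n.factorial),
      (F.card : ℝ) ≤ (C.card * (D.choose r * (3 / 4) ^ (T * r)) + C.card ^ 2 * (3 / 4) ^ (L T))
        * Nat.card (V → TrialIndex n T (L T) → Fin n.factorial) ∧
      ∀ ω ∉ F, ∃ O : Finset (Sym2 V × V), IsCliqueOverlay G C O ∧ overlayCongestion G O ≤ 2 ∧
        KnowsOverlay G id C O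
          fun u => (nodeAt n T L bits G id input ω (2 * (T + 1) + 7) u).output := by
  have hNpos : 0 < C.card := card_pos.2 ⟨w, hC.leader_mem⟩
  have : Nonempty (Fin n.factorial) := ⟨⟨0, n.factorial_pos⟩⟩
  let ω₀ : V → TrialIndex n T (L T) → Fin n.factorial := fun _ _ => ⟨0, n.factorial_pos⟩
  let lab : V → ℕ := fun x => (nodeAt n T L bits G id input ω₀ 7 x).lab
  obtain ⟨hinj, himage⟩ : Set.InjOn lab C ∧ C.image lab = range C.card := lab_bijOn hC
  -- The inverse of the labelling; the default `w` is never reached for labels below `C.card`.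
  let ν : ℕ → V := fun c => if h : ∃ x ∈ C, lab x = c then h.choose else w
  have hν : ∀ c < C.card, ν c ∈ C ∧ lab (ν c) = c := by
    intro c hc
    have hex : ∃ x ∈ C, lab x = c := by
      rw [← mem_range, ← himage] at hc
      exact mem_image.1 hc
    simp only [ν, dif_pos hex]
    exact hex.choose_spec
  let κ : ℕ × ℕ × ℕ × ℕ → V × TrialIndex n T (L T) := fun p =>
    (ν p.2.1, trialIndex n T (L T) p.1 p.2.2.1 p.2.2.2)
  have hLle : ∀ t ≤ T, L t ≤ L T := by
    intro t ht
    rcases ht.lt_or_eq with ht | rfl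
    · rw [hL t ht]; exact hLT
    · exact le_rfl
  have hκ : Set.InjOn κ (trialBox C.card T L) := by
    rintro ⟨t, u, v, l⟩ ⟨h1, h2, h3, h4⟩ ⟨t', u', v', l'⟩ ⟨g1, g2, g3, g4⟩ h
    dsimp only at h1 h2 h3 h4 g1 g2 g3 g4
    simp only [κ, Prod.mk.injEq] at h
    have hu : u = u' := by
      rw [← (hν u (h2.trans h3)).2, ← (hν u' (g2.trans g3)).2, h.1]
    have := hLle t h1
    have := hLle t' g1
    obtain ⟨rfl, rfl, rfl⟩ := trialIndex_inj h1 g1 (by omega) (by omega) (by omega) (by omega) h.2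
    rw [hu]
  let Y : (V → TrialIndex n T (L T) → Fin n.factorial) → ℕ → ℕ → ℕ → ℕ → ℕ := fun ω =>
    choices C.card (fun a : Fin n.factorial => (a : ℕ)) κ fun q => ω q.1 q.2
  have hlabelled : ∀ ω, IsLabelled n T L bits E G id input ω C w lab (Y ω) := by
    intro ω
    refine ⟨hC, fun x => nodeAt_lab_indep ω₀ x, ?_⟩
    intro x hx t v l
    have hx' : lab x < C.card := by
      rw [← mem_range, ← himage]
      exact mem_image_of_mem _ hx
    have hνx : ν (lab x) = x := hinj (hν _ hx').1 hx (hν _ hx').2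
    simp only [Y, choices, κ, hνx]
  have hdeg' : ∀ c < C.card, ((range C.card).filter fun d => ¬ labelAdj G C lab c d).card ≤ D := by
    intro c hc
    obtain ⟨hx, hxc⟩ := hν c hc
    refine le_trans ?_ (hdeg _ hx)
    rw [← himage]
    refine le_trans (card_le_card (t := (C.filter fun z => ¬ G.Adj (ν c) z).image lab) ?_)
      card_image_le
    intro d hd
    obtain ⟨hd, hnot⟩ := mem_filter.1 hd
    obtain ⟨z, hz, rfl⟩ := mem_image.1 hd
    refine mem_image_of_mem _ (mem_filter.2 ⟨hz, fun hadj => hnot ?_⟩)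
    exact ⟨ν c, hx, z, hz, hxc, rfl, hadj⟩
  have hval : ∀ B : Finset ℕ, (univ.filter fun a : Fin n.factorial => (a : ℕ) % C.card ∈ B).card
      * C.card ≤ B.card * Fintype.card (Fin n.factorial) := by
    intro B
    rw [Fintype.card_fin]
    exact card_filter_mod_mem_le _ _ (Nat.dvd_factorial hNpos hn) B
  have hfail := card_process_fail_le (ι := V × TrialIndex n T (L T)) (R := labelAdj G C lab) hNpos
    (fun _ _ => labelAdj_symm _ _) hκ hval hL hD hdeg' hr
  refine ⟨univ.filter fun ω => ∃ u v, u < v ∧ v < C.card ∧ ¬ labelAdj G C lab u v ∧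
    -- Seeds per node and seeds per (node, index) are identified by currying.
    (pstate C.card (labelAdj G C lab) L (Y ω) (T + 1)).out u v = none, ?_, ?_⟩
  · have hcard : Nat.card (V → TrialIndex n T (L T) → Fin n.factorial)
        = Nat.card (V × TrialIndex n T (L T) → Fin n.factorial) :=
      Nat.card_congr (Equiv.curry _ _ _).symm
    rw [← Nat.card_eq_fintype_card] at hfail
    rw [hcard]
    refine le_trans (Nat.cast_le.2 ?_) hfail
    refine card_le_card_of_injOn (fun ω q => ω q.1 q.2) ?_ ?_
    · intro ω hω
      exact mem_filter.2 ⟨mem_univ _, (mem_filter.1 hω).2⟩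
    · intro ω _ ω' _ h
      funext x q
      exact congrFun h (x, q)
  · intro ω hω
    refine (hlabelled ω).exists_overlay fun u v huv hv hnR hnone => hω ?_
    exact mem_filter.2 ⟨mem_univ _, u, v, huv, hv, hnR, hnone⟩

/-! ### Parameters -/

/-- The number of bits of `n`. -/
def bitLen (n : ℕ) : ℕ := Nat.log 2 n + 1

theorem lt_two_pow_bitLen (n : ℕ) : n < 2 ^ bitLen n := Nat.lt_pow_succ_log_self one_lt_two n

theorem bitLen_le {n : ℕ} (hn : 2 ≤ n) : (bitLen n : ℝ) ≤ 3 * Real.log n := by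
  have h2 := Real.log_two_gt_d9
  have h1 : (Nat.log 2 n : ℝ) * Real.log 2 ≤ Real.log n := by
    rw [← Real.log_pow]
    refine Real.log_le_log (by positivity) ?_
    exact_mod_cast Nat.pow_log_le_self 2 (by omega)
  have h3 : Real.log 2 ≤ Real.log n := Real.log_le_log (by norm_num) (by exact_mod_cast hn)
  have h4 : (0 : ℝ) ≤ Nat.log 2 n := Nat.cast_nonneg _
  unfold bitLen
  push_cast
  nlinarith

/-- Trials in the last phase. -/
def lastTrials (k n : ℕ) : ℕ := 3 * (k + 4) * bitLen n

theorem lastTrials_pos (k n : ℕ) : 0 < lastTrials k n := by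
  rw [lastTrials, bitLen]
  positivity

/-- Phases before the last one. -/
def numPhases (k n : ℕ) : ℕ := 3 * Nat.clog 2 (6 * lastTrials k n)

/-- Trials in each phase. -/
def numTrials (k n t : ℕ) : ℕ := if t < numPhases k n then 1 else lastTrials k n

theorem three_quarters_pow_le (m : ℕ) : (3 / 4 : ℝ) ^ (3 * m) ≤ (1 / 2) ^ m := by
  rw [pow_mul]
  exact pow_le_pow_left₀ (by norm_num) (by norm_num) m

theorem half_pow_bitLen_le (n m : ℕ) (hn : 0 < n) :
    (1 / 2 : ℝ) ^ (m * bitLen n) ≤ (1 / n) ^ m := by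
  rw [mul_comm, pow_mul]
  refine pow_le_pow_left₀ (by positivity) ?_ m
  rw [div_pow, one_pow]
  have : (n : ℝ) ≤ 2 ^ bitLen n := by exact_mod_cast (lt_two_pow_bitLen n).le
  exact one_div_le_one_div_of_le (by exact_mod_cast hn) this

/-- The usual `(eD/r)^r` bound, from `r^r / r! ≤ e^r` and `e < 3`. -/
theorem choose_le_of_le_mul {D l r : ℕ} (h : D ≤ l * r) : (D.choose r : ℝ) ≤ (3 * l) ^ r := by
  have h1 : (r : ℝ) ^ r / r.factorial ≤ 3 ^ r := by
    calc (r : ℝ) ^ r / r.factorial ≤ Real.exp r := Real.pow_div_factorial_le_exp _ (by positivity) r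
      _ = Real.exp 1 ^ r := by rw [← Real.exp_nat_mul, mul_one]
      _ ≤ 3 ^ r := pow_le_pow_left₀ (Real.exp_pos _).le
          (by have := Real.exp_one_lt_d9; linarith) r
  calc (D.choose r : ℝ) ≤ (D : ℝ) ^ r / r.factorial := Nat.choose_le_pow_div r D
    _ ≤ ((l * r : ℕ) : ℝ) ^ r / r.factorial := by gcongr
    _ = l ^ r * ((r : ℝ) ^ r / r.factorial) := by push_cast; rw [mul_pow]; ring
    _ ≤ l ^ r * 3 ^ r := by gcongr
    _ = _ := by rw [mul_pow]; ring

/-- The extra factor `n` on the left pays for the union bound over the clusters. -/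
theorem fail_bound (k n N : ℕ) (hn : 2 ≤ n) (hNn : N ≤ n)
    (hN : 24 * (k + 4) ^ 2 * bitLen n ^ 2 ≤ N) :
    ∃ r : ℕ, (∀ m < r, 8 * (lastTrials k n * m) ≤ N) ∧
      (n : ℝ) * (N * ((N / 8).choose r * (3 / 4) ^ (numPhases k n * r))
        + N ^ 2 * (3 / 4) ^ lastTrials k n) ≤ 1 / n ^ k := by
  set l := lastTrials k n with hl
  have hb : 0 < bitLen n := Nat.succ_pos _
  have hlpos : 0 < l := lastTrials_pos k n
  have hn0 : (0 : ℝ) < n := by exact_mod_cast (by omega : 0 < n)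
  have hNn' : (N : ℝ) ≤ n := by exact_mod_cast hNn
  -- The threshold serves both sides: `m < r` means that `l * m` trials fit into `N / 8` colours,
  -- while `N / 8 ≤ l * r` controls the binomial coefficient.
  refine ⟨N / 8 / l + 1, ?_, ?_⟩
  · intro m hm
    have h1 : m * l ≤ N / 8 := (Nat.le_div_iff_mul_le hlpos).1 (by omega)
    rw [mul_comm m] at h1
    omega
  set r := N / 8 / l + 1 with hr
  have hDr : N / 8 ≤ l * r := (Nat.lt_mul_div_succ (N / 8) hlpos).le
  have hrb : (k + 3) * bitLen n ≤ r := by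
    have : (k + 3) * bitLen n ≤ N / 8 / l := by
      rw [Nat.div_div_eq_div_mul, Nat.le_div_iff_mul_le (by omega), hl, lastTrials]
      calc (k + 3) * bitLen n * (8 * (3 * (k + 4) * bitLen n))
          = 24 * ((k + 3) * (k + 4)) * bitLen n ^ 2 := by ring
        _ ≤ 24 * (k + 4) ^ 2 * bitLen n ^ 2 := by gcongr; nlinarith
        _ ≤ N := hN
    omega
  have h1 : ((N / 8).choose r : ℝ) * (3 / 4) ^ (numPhases k n * r) ≤ (1 / n) ^ (k + 3) := by
    -- As `(3/4)^3 ≤ 1/2`, the single-trial phases give a factor at most `1 / (6l)` per non-edge,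
    -- against `3l` from the binomial coefficient: `1/2` remains, to the power `r ≥ (k + 3) * bitLen
    -- n`.
    have hτ : (6 * l : ℝ) ≤ 2 ^ Nat.clog 2 (6 * l) := by
      exact_mod_cast Nat.le_pow_clog one_lt_two (6 * l)
    have hl0 : (0 : ℝ) < l := by exact_mod_cast hlpos
    calc ((N / 8).choose r : ℝ) * (3 / 4) ^ (numPhases k n * r)
        ≤ (3 * l) ^ r * ((1 / 2) ^ Nat.clog 2 (6 * l)) ^ r := by
          refine mul_le_mul (choose_le_of_le_mul hDr) ?_ (by positivity) (by positivity)
          rw [numPhases, pow_mul]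
          exact pow_le_pow_left₀ (by positivity) (three_quarters_pow_le _) r
      _ = (3 * l / 2 ^ Nat.clog 2 (6 * l)) ^ r := by
          rw [← mul_pow, div_pow, one_pow, mul_one_div]
      _ ≤ (1 / 2) ^ r := by
          refine pow_le_pow_left₀ (by positivity) ?_ r
          rw [div_le_iff₀ (by positivity)]
          linarith
      _ ≤ (1 / 2) ^ ((k + 3) * bitLen n) :=
          pow_le_pow_of_le_one (by norm_num) (by norm_num) hrb
      _ ≤ _ := half_pow_bitLen_le n _ (by omega)
  have h2 : (3 / 4 : ℝ) ^ l ≤ (1 / n) ^ (k + 4) := by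
    rw [hl, lastTrials, mul_assoc]
    exact (three_quarters_pow_le _).trans (half_pow_bitLen_le n _ (by omega))
  calc (n : ℝ) * (N * ((N / 8).choose r * (3 / 4) ^ (numPhases k n * r)) + N ^ 2 * (3 / 4) ^ l)
      -- Both summands become `n^(-k-1)`, and `2 / n ≤ 1`.
      ≤ (n : ℝ) * (n * (1 / n) ^ (k + 3) + n ^ 2 * (1 / n) ^ (k + 4)) := by gcongr
    _ = (2 : ℝ) / n * (1 / (n : ℝ) ^ k) := by
        simp only [one_div, inv_pow]
        field_simp
        ring
    _ ≤ 1 * (1 / (n : ℝ) ^ k) := by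
        gcongr
        rw [div_le_one hn0]
        exact_mod_cast hn
    _ = _ := one_mul _

theorem rounds_le (k : ℕ) : ∃ K : ℝ, ∀ n : ℕ, 3 ≤ n →
    ((2 * (numPhases k n + 1) + 7 : ℕ) : ℝ) ≤ K * Real.log (Real.log n) := by
  set A := Real.log (Real.log 3) with hA
  set c₁ := Real.log (54 * (k + 4)) with hc₁
  have hlog3 : 1 < Real.log 3 := by
    rw [Real.lt_log_iff_exp_lt (by norm_num)]
    have := Real.exp_one_lt_d9
    linarith
  have hA0 : 0 < A := Real.log_pos hlog3
  have hc0 : 0 ≤ c₁ := Real.log_nonneg (by have : (0 : ℝ) ≤ k := Nat.cast_nonneg k; linarith)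
  -- There are `6 * clog + 9` rounds and `clog ≤ 1 + (3/2) * (c₁ + log log n)`, because `1 / log 2 ≤
  -- 3/2`. The constant part is absorbed using `log log n ≥ A > 0`, which holds because `3 > e`.
  refine ⟨(15 + 9 * c₁) / A + 9, fun n hn => ?_⟩
  have hn3 : Real.log 3 ≤ Real.log n := Real.log_le_log (by norm_num) (by exact_mod_cast hn)
  have hx : A ≤ Real.log (Real.log n) := Real.log_le_log (by linarith) hn3
  set x := Real.log (Real.log n) with hxdef
  set l := lastTrials k n with hl
  have hlpos : 0 < l := lastTrials_pos k n
  have hlle : (6 * l : ℝ) ≤ 54 * (k + 4) * Real.log n := by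
    have := bitLen_le (n := n) (by omega)
    rw [hl, lastTrials]
    push_cast
    have hk : (0 : ℝ) ≤ k := Nat.cast_nonneg k
    nlinarith
  have hlog : Real.log (6 * l) ≤ c₁ + x := by
    rw [hc₁, hxdef, ← Real.log_mul (by positivity) (by linarith)]
    exact Real.log_le_log (by positivity) hlle
  clear_value l
  have hτ : ((Nat.clog 2 (6 * l) : ℕ) : ℝ) ≤ 1 + (c₁ + x) * (3 / 2) := by
    have hpos : 0 < Nat.clog 2 (6 * l) := Nat.clog_pos one_lt_two (by omega)
    have hlt : 2 ^ (Nat.clog 2 (6 * l) - 1) < 6 * l := 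
      (Nat.lt_clog_iff_pow_lt one_lt_two).1 (by omega)
    have h1 : ((Nat.clog 2 (6 * l) - 1 : ℕ) : ℝ) * Real.log 2 ≤ Real.log (6 * l) := by
      rw [← Real.log_pow]
      refine Real.log_le_log (by positivity) ?_
      exact_mod_cast hlt.le
    rw [Nat.cast_sub hpos] at h1
    have h2 := Real.log_two_gt_d9
    push_cast at h1
    nlinarith
  have hround : ((2 * (numPhases k n + 1) + 7 : ℕ) : ℝ) = 6 * (Nat.clog 2 (6 * l) : ℕ) + 9 := by
    rw [numPhases, ← hl]
    push_cast
    ring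
  have hdiv : 15 + 9 * c₁ ≤ (15 + 9 * c₁) / A * x := by
    rw [div_mul_eq_mul_div, le_div_iff₀ hA0]
    exact mul_le_mul_of_nonneg_left hx (by linarith)
  rw [hround]
  linarith

/-- `n ^ a + n` dominates IDs, shifted AC-IDs and cluster sizes; the square accounts for `Nat.pair`.
-/
theorem bits_bound (a n : ℕ) : (n ^ a + n + 1) ^ 2 ≤ 2 ^ (2 * (a + 2) * bitLen n) := by
  have hn := lt_two_pow_bitLen n
  have hb : 1 ≤ bitLen n := Nat.succ_pos _
  have h1 : n ^ a ≤ 2 ^ ((a + 1) * bitLen n) :=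
    calc n ^ a ≤ (2 ^ bitLen n) ^ a := Nat.pow_le_pow_left hn.le a
      _ = 2 ^ (a * bitLen n) := by rw [← pow_mul, mul_comm]
      _ ≤ _ := Nat.pow_le_pow_right two_pos (by nlinarith)
  have h2 : n + 1 ≤ 2 ^ ((a + 1) * bitLen n) :=
    hn.trans_le (Nat.pow_le_pow_right two_pos (by nlinarith))
  have h3 : n ^ a + n + 1 ≤ 2 ^ ((a + 2) * bitLen n) :=
    calc n ^ a + n + 1 ≤ 2 ^ ((a + 1) * bitLen n + 1) := by rw [pow_succ]; omega
      _ ≤ _ := Nat.pow_le_pow_right two_pos (by nlinarith)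
  calc (n ^ a + n + 1) ^ 2 ≤ (2 ^ ((a + 2) * bitLen n)) ^ 2 := Nat.pow_le_pow_left h3 2
    _ = _ := by rw [← pow_mul]; congr 1; ring

end CliqueOverlay

/-! ### Almost-cliques satisfy the requirements; union bound over the family. -/

namespace CliqueOverlay

open Finset

/-- The bound `1/15` is exactly what is needed: `7(1 + ε) ≤ 8(1 - ε)`, so at least `7/8` of `C` is
adjacent to `x`. The node `x` itself is counted among the non-adjacent ones. -/
theorem not_adj_card_le {V : Type} [Fintype V] [DecidableEq V] {G : SimpleGraph V}
    [DecidableRel G.Adj] {ε : ℝ} (hε : ε ≤ 1 / 15) {C : Finset V} (hC : IsAlmostClique G ε C)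
    {x : V} (hx : x ∈ C) : (C.filter fun z => ¬ G.Adj x z).card ≤ C.card / 8 := by
  obtain ⟨-, h2, h3⟩ := hC
  have h3 := h3 x hx
  have hsplit : (G.neighborFinset x ∩ C).card + (C.filter fun z => ¬ G.Adj x z).card = C.card := by
    rw [← card_filter_add_card_filter_not (s := C) (fun z => G.Adj x z)]
    congr 2
    ext z
    simp [and_comm]
  have hΔ : (0 : ℝ) ≤ G.maxDegree := Nat.cast_nonneg _
  have hs : ((G.neighborFinset x ∩ C).card : ℝ) + (C.filter fun z => ¬ G.Adj x z).card = C.card := by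
    exact_mod_cast hsplit
  have : (8 : ℝ) * (C.filter fun z => ¬ G.Adj x z).card ≤ C.card := by nlinarith
  have : 8 * (C.filter fun z => ¬ G.Adj x z).card ≤ C.card := by exact_mod_cast this
  omega

/-- Two nodes together miss at most a quarter of `C`. -/
theorem exists_common_neighbor {V : Type} {G : SimpleGraph V} [DecidableRel G.Adj] {C : Finset V}
    (hC : C.Nonempty) (hdeg : ∀ x ∈ C, (C.filter fun z => ¬ G.Adj x z).card ≤ C.card / 8) {x y : V}
    (hx : x ∈ C) (hy : y ∈ C) : ∃ z ∈ C, G.Adj x z ∧ G.Adj y z := by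
  classical
  by_contra hno
  push Not at hno
  have hsub : C ⊆ (C.filter fun z => ¬ G.Adj x z) ∪ C.filter fun z => ¬ G.Adj y z := by
    intro z hz
    by_cases h : G.Adj x z
    · exact mem_union_right _ (mem_filter.2 ⟨hz, hno z hz h⟩)
    · exact mem_union_left _ (mem_filter.2 ⟨hz, h⟩)
  have h1 := (card_le_card hsub).trans (card_union_le _ _)
  have h2 := hdeg x hx
  have h3 := hdeg y hy
  have h4 := hC.card_pos
  omega

/-- The algorithm. -/
noncomputable def overlayAlgorithm (a k n : ℕ) : CongestAlgorithm CliqueInput (ℕ → Option ℕ) :=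
  (overlayCode n (numPhases k n) (numTrials k n)).toCongest (2 * (a + 2) * bitLen n)
    (2 * (numPhases k n + 1) + 7)

theorem overlayAlgorithm_run {V : Type} [Fintype V] [DecidableEq V] (a k n : ℕ)
    (G : SimpleGraph V) [DecidableRel G.Adj] (id : V ↪ ℕ) (input : V → CliqueInput)
    (ω : V → (overlayAlgorithm a k n).Seed) :
    (overlayAlgorithm a k n).run G id input ω = fun u =>
      (nodeAt n (numPhases k n) (numTrials k n) (2 * (a + 2) * bitLen n) G id input ω
        (2 * (numPhases k n + 1) + 7) u).output :=
  funext fun u => Code.run_toCongest (overlayCode n (numPhases k n) (numTrials k n)) _ _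
    G id input ω u

/-- The seeds with which the algorithm fails in a given cluster. -/
theorem exists_fail_set_overlayAlgorithm {V : Type} [Fintype V] [DecidableEq V] {a k n E : ℕ}
    {G : SimpleGraph V} [DecidableRel G.Adj] {id : V ↪ ℕ} {input : V → CliqueInput}
    {C : Finset V} {w : V} (hC : IsCluster (2 * (a + 2) * bitLen n) E G id input C w)
    (hn2 : 2 ≤ n) (hn : C.card ≤ n) (hsize : 24 * (k + 4) ^ 2 * bitLen n ^ 2 ≤ C.card)
    (hdeg : ∀ x ∈ C, (C.filter fun z => ¬ G.Adj x z).card ≤ C.card / 8) :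
    ∃ F : Finset (V → (overlayAlgorithm a k n).Seed),
      (F.card : ℝ) ≤ 1 / (n : ℝ) ^ k / n * Nat.card (V → (overlayAlgorithm a k n).Seed) ∧
      ∀ ω ∉ F, ∃ O : Finset (Sym2 V × V), IsCliqueOverlay G C O ∧ overlayCongestion G O ≤ 2 ∧
        KnowsOverlay G id C O ((overlayAlgorithm a k n).run G id input ω) := by
  have hL : ∀ t < numPhases k n, numTrials k n t = 1 := fun t ht => if_pos ht
  have hLT : numTrials k n (numPhases k n) = lastTrials k n := if_neg (lt_irrefl _)
  have hpos := lastTrials_pos k n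
  obtain ⟨r, hr, hbound⟩ := fail_bound k n C.card hn2 hn hsize
  rw [← hLT] at hr hbound hpos
  obtain ⟨F, hF, hF'⟩ := exists_fail_set hC hn hL hpos (by omega) hdeg hr
  refine ⟨F, ?_, ?_⟩
  · refine hF.trans (mul_le_mul_of_nonneg_right ?_ (Nat.cast_nonneg _))
    rw [le_div_iff₀ (by exact_mod_cast (by omega : 0 < n)), mul_comm]
    exact hbound
  · intro ω hω
    rw [overlayAlgorithm_run]
    exact hF' ω hω

theorem one_sub_le_prob {In Out V : Type} [Fintype V] [DecidableEq V]
    (A : CongestAlgorithm In Out) (F : V → Finset (V → A.Seed)) (E : Set (V → A.Seed)) (q : ℝ)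
    (hF : ∀ v, ((F v).card : ℝ) ≤ q * Nat.card (V → A.Seed))
    (hE : ∀ ω, (∀ v, ω ∉ F v) → ω ∈ E) : 1 - Fintype.card V * q ≤ A.prob E := by
  classical
  have hW : (0 : ℝ) < Fintype.card (V → A.Seed) := by exact_mod_cast Fintype.card_pos
  have hU : (((univ.biUnion F).card : ℕ) : ℝ) ≤ Fintype.card V * q * Fintype.card (V → A.Seed) := by
    calc (((univ.biUnion F).card : ℕ) : ℝ) ≤ ∑ v, ((F v).card : ℝ) := by
          exact_mod_cast card_biUnion_le
      _ ≤ ∑ _v : V, q * Fintype.card (V → A.Seed) := by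
          refine sum_le_sum fun v _ => ?_
          rw [← Nat.card_eq_fintype_card]
          exact hF v
      _ = _ := by simp [mul_assoc]
  have hcompl : (univ.biUnion F)ᶜ.card ≤ E.ncard := by
    rw [← Set.ncard_coe_finset]
    refine Set.ncard_le_ncard (fun ω hω => hE ω fun v hv => ?_) (Set.toFinite _)
    exact mem_compl.1 (mem_coe.1 hω) (mem_biUnion.2 ⟨v, mem_univ _, hv⟩)
  have hsum : ((univ.biUnion F).card : ℝ) + ((univ.biUnion F)ᶜ.card : ℕ)
      = Fintype.card (V → A.Seed) := by
    exact_mod_cast card_add_card_compl (univ.biUnion F)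
  have hcompl' : (((univ.biUnion F)ᶜ.card : ℕ) : ℝ) ≤ E.ncard := by exact_mod_cast hcompl
  rw [CongestAlgorithm.prob, le_div_iff₀ hW]
  linarith

/-- The hypothesis forces a positive maximum degree, hence an edge. -/
theorem two_le_of_log_sq_lt {V : Type} [Fintype V] {G : SimpleGraph V}
    [DecidableRel G.Adj] {c ε : ℝ} (hc : 0 ≤ c)
    (h : c * Real.log (Fintype.card V : ℝ) ^ 2 < ε * (G.maxDegree : ℝ)) :
    2 ≤ Fintype.card V := by
  have hpos : 0 < ε * (G.maxDegree : ℝ) := lt_of_le_of_lt (by positivity) h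
  by_contra hcard
  have hsub : Subsingleton V := Fintype.card_le_one_iff_subsingleton.1 (by omega)
  have : G.maxDegree = 0 := by
    refine Nat.le_zero.1 (G.maxDegree_le_of_forall_degree_le 0 fun v => ?_)
    rw [Nat.le_zero, ← SimpleGraph.card_neighborFinset_eq_degree, card_eq_zero]
    ext u
    simp [Subsingleton.elim u v]
  rw [this, Nat.cast_zero, mul_zero] at hpos
  exact lt_irrefl _ hpos

/-- Here `|C| ≥ (1 - ε)Δ ≥ εΔ`, and `216 = 24 * 3 ^ 2` with the `3` of `bitLen_le`. -/
theorem bitLen_sq_le_card {V : Type} [Fintype V] [DecidableEq V] {G : SimpleGraph V}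
    [DecidableRel G.Adj] {ε : ℝ} (hε : ε ≤ 1 / 15) {k n : ℕ}
    (h : 216 * (k + 4 : ℝ) ^ 2 * Real.log (n : ℝ) ^ 2 < ε * (G.maxDegree : ℝ)) (hn2 : 2 ≤ n)
    {C : Finset V} (hC : IsAlmostClique G ε C) :
    24 * (k + 4) ^ 2 * bitLen n ^ 2 ≤ C.card := by
  have hb := bitLen_le hn2
  have hΔ : (0 : ℝ) ≤ G.maxDegree := Nat.cast_nonneg _
  have h1 : ε * (G.maxDegree : ℝ) ≤ C.card := le_trans (by nlinarith) hC.1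
  have h2 : (bitLen n : ℝ) ^ 2 ≤ (3 * Real.log n) ^ 2 := pow_le_pow_left₀ (Nat.cast_nonneg _) hb 2
  have h3 : 24 * (k + 4 : ℝ) ^ 2 * (bitLen n : ℝ) ^ 2 ≤ C.card := by
    calc 24 * (k + 4 : ℝ) ^ 2 * (bitLen n : ℝ) ^ 2 ≤ 24 * (k + 4 : ℝ) ^ 2 * (3 * Real.log n) ^ 2 := by
          gcongr
      _ = 216 * (k + 4 : ℝ) ^ 2 * Real.log (n : ℝ) ^ 2 := by ring
      _ ≤ C.card := h.le.trans h1
  exact_mod_cast h3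

end CliqueOverlay

open CliqueOverlay in
theorem mainTheorem7 (a : ℕ) :
    ∃ B : ℝ, ∀ k : ℕ, ∃ (c K : ℝ) (A : ℕ → CongestAlgorithm CliqueInput (ℕ → Option ℕ)),
      0 < c ∧
      (∀ n : ℕ, 3 ≤ n →
        ((A n).rounds : ℝ) ≤ K * Real.log (Real.log (n : ℝ)) ∧
        ((A n).msgBits : ℝ) ≤ B * Real.log (n : ℝ)) ∧
      ∀ (n : ℕ) (V : Type) [Fintype V] [DecidableEq V] (G : SimpleGraph V) [DecidableRel G.Adj]
        (id : V ↪ ℕ) (input : V → CliqueInput) (ε : ℝ),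
        Fintype.card V = n →
        (∀ v, id v < n ^ a) →
        ε ≤ 1 / 15 →
        c * Real.log (n : ℝ) ^ 2 < ε * (G.maxDegree : ℝ) →
        (∀ i, (acNodes input i).Nonempty →
          i < n ^ a ∧ IsAlmostClique G ε (acNodes input i) ∧
          ∃! w, w ∈ acNodes input i ∧ (input w).isLeader = true) →
        1 - 1 / (n : ℝ) ^ k ≤
          (A n).prob {ω : V → (A n).Seed |
            ∀ i, (acNodes input i).Nonempty →
              ∃ O : Finset (Sym2 V × V),
                IsCliqueOverlay G (acNodes input i) O ∧
                overlayCongestion G O ≤ 2 ∧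
                KnowsOverlay G id (acNodes input i) O ((A n).run G id input ω)} := by
  refine ⟨2 * (a + 2) * 3, fun k => ?_⟩
  obtain ⟨K, hK⟩ := rounds_le k
  refine ⟨216 * (k + 4) ^ 2, K, overlayAlgorithm a k, by positivity, fun n hn => ⟨hK n hn, ?_⟩, ?_⟩
  · have hb := bitLen_le (n := n) (by omega)
    have : ((2 * (a + 2) * bitLen n : ℕ) : ℝ) ≤ 2 * (a + 2) * 3 * Real.log n := by
      push_cast
      have ha : (0 : ℝ) ≤ a := Nat.cast_nonneg a
      nlinarith
    exact this
  intro n V _ _ G _ id input ε hcard hid hε hc hfam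
  have hn2 := two_le_of_log_sq_lt (G := G) (ε := ε) (by positivity) (hcard ▸ hc)
  rw [hcard] at hn2
  have hmem : ∀ i v, v ∈ acNodes input i ↔ (input v).acId = some i := fun i v => by simp [acNodes]
  have hsize : ∀ i, (acNodes input i).card ≤ n := fun i => hcard ▸ Finset.card_le_univ _
  have hdeg : ∀ i, (acNodes input i).Nonempty → ∀ x ∈ acNodes input i,
      ((acNodes input i).filter fun z => ¬ G.Adj x z).card ≤ (acNodes input i).card / 8 :=
    fun i hi x hx => not_adj_card_le hε (hfam i hi).2.1 hx
  have hcluster : ∀ i, (acNodes input i).Nonempty → ∃ w, IsCluster (2 * (a + 2) * bitLen n)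
      (n ^ a + n) G id input (acNodes input i) w := by
    intro i hi
    obtain ⟨w, ⟨hw, hlead⟩, huniq⟩ := (hfam i hi).2.2
    refine ⟨w, bits_bound a n, fun v => (hid v).le.trans (Nat.le_add_right _ _), ?_,
      (hsize i).trans (Nat.le_add_left _ _), ⟨i, hmem i⟩, hw, ?_, ?_⟩
    · intro v j hj
      exact (hfam j ⟨v, (hmem j v).2 hj⟩).1.trans_le (Nat.le_add_right _ _)
    · intro v hv
      exact ⟨fun h => huniq v ⟨hv, h⟩, fun h => h ▸ hlead⟩
    · intro x hx y hy
      exact exists_common_neighbor hi (hdeg i hi) hx hy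
  -- Failures are indexed by nodes instead of AC-IDs: each member of the family is charged to any of
  -- its nodes, so `n` sets of density at most `n^(-k-1)` suffice.
  have hfail : ∀ v : V, ∃ F : Finset (V → (overlayAlgorithm a k n).Seed),
      (F.card : ℝ) ≤ 1 / (n : ℝ) ^ k / n * Nat.card (V → (overlayAlgorithm a k n).Seed) ∧
      ∀ ω ∉ F, ∀ i, v ∈ acNodes input i → ∃ O : Finset (Sym2 V × V),
        IsCliqueOverlay G (acNodes input i) O ∧ overlayCongestion G O ≤ 2 ∧
        KnowsOverlay G id (acNodes input i) O ((overlayAlgorithm a k n).run G id input ω) := by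
    intro v
    cases hv : (input v).acId with
    | none =>
      refine ⟨∅, by simp only [Finset.card_empty, Nat.cast_zero]; positivity, ?_⟩
      intro ω _ i hi
      rw [hmem, hv] at hi
      cases hi
    | some i =>
      have hi : (acNodes input i).Nonempty := ⟨v, (hmem i v).2 hv⟩
      obtain ⟨w, hw⟩ := hcluster i hi
      obtain ⟨F, hF, hF'⟩ := exists_fail_set_overlayAlgorithm hw hn2 (hsize i)
        (bitLen_sq_le_card hε hc hn2 (hfam i hi).2.1) (hdeg i hi)
      refine ⟨F, hF, fun ω hω j hj => ?_⟩
      rw [hmem, hv] at hj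
      obtain rfl := Option.some_injective _ hj
      exact hF' ω hω
  choose F hF hF' using hfail
  have hprob := one_sub_le_prob (overlayAlgorithm a k n) F
    {ω | ∀ i, (acNodes input i).Nonempty → ∃ O : Finset (Sym2 V × V),
      IsCliqueOverlay G (acNodes input i) O ∧ overlayCongestion G O ≤ 2 ∧
      KnowsOverlay G id (acNodes input i) O ((overlayAlgorithm a k n).run G id input ω)}
    _ hF (by
      rintro ω hω i ⟨v, hv⟩
      exact hF' v ω (hω v) i hv)
  rw [hcard, mul_div_cancel₀ _ (by exact_mod_cast (by omega : n ≠ 0))] at hprob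
  exact hprob
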